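/- Let $d,q\ge 1$ and let $\Omega=\{1,\dots,q\}^{\mathbb Z^d}$ carry the product topology and its Borel $\sigma$-algebra. For finite $\Delta\subset\mathbb Z^d$ let $c_\Delta(\eta,\sigma_\Delta)\ge 0$ ($\eta\in\Omega$, $\sigma_\Delta\in\{1,\dots,q\}^\Delta$) be jump rates, continuous in $\eta$, and put $c_\Delta(\eta)=\sum_{\sigma_\Delta}c_\Delta(\eta,\sigma_\Delta)$, $c_\Delta=\sup_\eta c_\Delta(\eta)$, and $$Lf(\eta)=\sum_{\Delta}\sum_{\sigma_\Delta}c_\Delta(\eta,\sigma_\Delta)\,[f(\sigma_\Delta\eta_{\Delta^c})-f(\eta)].$$ Assume that $L$ is well-defined in the sense of Liggett, i.e. $\sup_x\sum_{\Delta\ni x}c_\Delta<\infty$ and $\sup_x\sum_{\Delta\ni x}\sum_{u\ne x}c_\Delta(u)<\infty$, where $c_\Delta(u)$ is the supremum of $\sum_{\sigma_\Delta}|c_\Delta(\eta,\sigma_\Delta)-c_\Delta(\zeta,\sigma_\Delta)|$ over all $\eta,\zeta$ that agree off $u$; that the rates are invariant under lattice translations; and that 1. (finitely many types of transitions) there is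 a finite $\Gamma\ni 0$ such that $c_\Delta=0$ whenever $0\in\Delta\not\subset\Gamma$; 2. (uniformly continuous rates) $\lim_{\Lambda\uparrow\mathbb Z^d}\sup_{\Delta\ni 0}\sup_{\eta,\xi,\sigma}|c_\Delta(\eta_\Lambda\xi_{\Lambda^c},\sigma_\Delta)-c_\Delta(\eta,\sigma_\Delta)|=0$; 3. (no trap states) $c_\Delta(\eta,\sigma_\Delta)>0$ implies $c_\Delta(\sigma_\Delta\eta_{\Delta^c})>0$; 4. (minimal transition rate) for every finite $\Delta$ with $c_\Delta>0$, $\inf\{c_\Delta(\eta,\sigma_\Delta): c_\Delta(\eta,\sigma_\Delta)>0\}>0$. For a translation-invariant probability measure $\nu$ on $\Omega$ write $\nu(\omega_\Lambda)$ for the probability of the cylinder $\{\xi:\xi_i=\omega_i\ \forall i\in\Lambda\}$, and use the conventions $\log 0=-\infty$, $0\cdot(-\infty)=0$. The specific entropy loss is $$g_L(\nu)=\lim_{m\to\infty}g_L^{(m)}(\nu),\qquad g_L^{(m)}(\nu)=\frac1{|Q_m|}\sum_{\omega_{Q_m}}\nu(L1_{\omega_{Q_m}})\log\nu(\omega_{Q_m}),\qquad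 Q_m=[-m,m]^d\cap\mathbb Z^d,$$ whenever the limit exists in $[-\infty,\infty]$. With $\Lambda_n=[-2^n+1,2^n-1]^d\cap\mathbb Z^d$ and $\tilde\Lambda_n=[-2^n+n+1,2^n-n-1]^d\cap\mathbb Z^d$, the approximated specific entropy loss is $\tilde g_L(\nu)=\lim_{n\to\infty}\tilde g_L^n(\nu)$, whenever the limit exists, where $$\tilde g^n_L(\nu)=\frac1{|\Lambda_n|}\sum_{i\in\tilde\Lambda_n}\sum_{\Delta\ni i}\sum_{\sigma_\Delta}\int\nu(d\eta)\,c_\Delta(\eta,\sigma_\Delta)\frac1{|\Delta|}\log\frac{\nu(\sigma_{\Delta\cap\Lambda_n}\mid\eta_{\Lambda_n\setminus\Delta})}{\nu(\eta_{\Delta\cap\Lambda_n}\mid\eta_{\Lambda_n\setminus\Delta})}.$$ Then for every translation-invariant probability measure $\nu$ on $\Omega$ (no non-nullness is assumed) the limit $\tilde g_L(\nu)$ exists in $[-\infty,\infty)$, and $$\tilde g_L(\nu)\ \ge\ \limsup_{m\to\infty}g_L^{(m)}(\nu);$$ in particular $\tilde g_L(\nu)\ge g_L(\nu)$ whenever $g_L(\nu)$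 exists. Moreover $\nu\mapsto\tilde g_L(\nu)\in[-\infty,\infty)$ is upper semicontinuous on the set of translation-invariant probability measures with respect to the weak topology. -/

import Mathlib

open MeasureTheory ProbabilityTheory Filter Topology
open scoped ENNReal

noncomputable section

namespace Attractor

/-- The lattice `ℤ^d`. -/
abbrev Site (d : ℕ) : Type := Fin d → ℤ

/-- Configurations with finite local state space of `q` symbols; topology and sigma-algebra are the
product ones. -/
abbrev Config (d q : ℕ) : Type := Site d → Fin q

/-- `σ_Δ η_{Δᶜ}`: the configuration equal to `σ` on `Δ` and to `η` off `Δ`. -/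
def patch {d q : ℕ} (Δ : Finset (Site d)) (σ : Δ → Fin q) (η : Config d q) : Config d q :=
  fun x => if h : x ∈ Δ then σ ⟨x, h⟩ else η x

/-- The cylinder event `ω_Λ = {ξ : ξ = ω on Λ}`. -/
def cyl {d q : ℕ} (Λ : Finset (Site d)) (ω : Config d q) : Set (Config d q) :=
  {ξ | ∀ x ∈ Λ, ξ x = ω x}

/-- The cylinder event given by a configuration `ω` on `Λ` only. -/
def localCyl {d q : ℕ} (Λ : Finset (Site d)) (ω : Λ → Fin q) : Set (Config d q) :=
  {ξ | ∀ x : Λ, ξ x = ω x}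

/-- The lattice translate `Δ + i`. -/
def translate {d : ℕ} (i : Site d) (Δ : Finset (Site d)) : Finset (Site d) :=
  Δ.map (addRightEmbedding i)

theorem add_mem_translate {d : ℕ} (i : Site d) (Δ : Finset (Site d)) (x : Δ) :
    (x : Site d) + i ∈ translate i Δ :=
  Finset.mem_map_of_mem (addRightEmbedding i) x.2

/-- The shift of a configuration by the lattice vector `i`. -/
def shift {d q : ℕ} (i : Site d) (η : Config d q) : Config d q := fun x => η (x + i)

/-- The jump rates `c_Δ(η, σ_Δ)` of an interacting particle system: nonnegative, and continuous in
the starting configuration `η`. -/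
structure JumpRates (d q : ℕ) where
  rate : (Δ : Finset (Site d)) → Config d q → (Δ → Fin q) → ℝ
  rate_nonneg : ∀ Δ η σ, 0 ≤ rate Δ η σ
  continuous_rate : ∀ Δ σ, Continuous fun η => rate Δ η σ

namespace JumpRates

variable {d q : ℕ} (c : JumpRates d q)

/-- `c_Δ(η) = ∑_σ c_Δ(η, σ)`. -/
def totalRate (Δ : Finset (Site d)) (η : Config d q) : ℝ := ∑ σ : Δ → Fin q, c.rate Δ η σ

/-- `c_Δ = sup_η c_Δ(η)`. -/
def maxRate (Δ : Finset (Site d)) : ℝ≥0∞ := ⨆ η : Config d q, ENNReal.ofReal (c.totalRate Δ η)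

/-- `c_Δ(u)`: the influence of the spin at `u` on the jump measure in `Δ`, that is the supremum of
the total variation norm of `c_Δ(η, ·) - c_Δ(ζ, ·)` over `η, ζ` that agree off `u`. -/
def influence (Δ : Finset (Site d)) (u : Site d) : ℝ≥0∞ :=
  ⨆ (η : Config d q) (ζ : Config d q) (_ : ∀ y, y ≠ u → η y = ζ y),
    ENNReal.ofReal (∑ σ : Δ → Fin q, |c.rate Δ η σ - c.rate Δ ζ σ|)

/-- Liggett's conditions under which the (closure of the) operator `L` below generates a Markov
semigroup: bounded single-site jump intensities and bounded total influence. -/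
structure WellDefined : Prop where
  intensity : (⨆ x : Site d, ∑' Δ : {Δ : Finset (Site d) // x ∈ Δ}, c.maxRate Δ.1) < ⊤
  influence : (⨆ x : Site d, ∑' Δ : {Δ : Finset (Site d) // x ∈ Δ},
    ∑' u : {u : Site d // u ≠ x}, c.influence Δ.1 u.1) < ⊤

/-- `c_{Δ+i}(η, σ)` is `c_Δ` at the configurations shifted back by `i`. -/
def TranslationInvariant : Prop :=
  ∀ (i : Site d) (Δ : Finset (Site d)) (η : Config d q) (σ : translate i Δ → Fin q),
    c.rate (translate i Δ) η σ =
      c.rate Δ (shift i η) (fun x => σ ⟨(x : Site d) + i, add_mem_translate i Δ x⟩)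

/-- Only finitely many types of transitions. -/
def FinitelyManyTypes : Prop :=
  ∃ Γ : Finset (Site d), 0 ∈ Γ ∧ ∀ Δ : Finset (Site d), 0 ∈ Δ → ¬ Δ ⊆ Γ → c.maxRate Δ = 0

/-- `sup_{Δ ∋ 0} sup_{η, ξ, σ} |c_Δ(η_Λ ξ_{Λᶜ}, σ) - c_Δ(η, σ)| → 0` as `Λ ↑ ℤ^d`. -/
def UniformlyContinuousRates : Prop :=
  ∀ ε : ℝ, 0 < ε → ∀ᶠ Λ : Finset (Site d) in atTop,
    ∀ Δ : Finset (Site d), 0 ∈ Δ → ∀ (η ξ : Config d q) (σ : Δ → Fin q),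
      |c.rate Δ (patch Λ (fun x => η x) ξ) σ - c.rate Δ η σ| ≤ ε

/-- `L` can not enter trap states. -/
def NoTrapStates : Prop :=
  ∀ (Δ : Finset (Site d)) (η : Config d q) (σ : Δ → Fin q),
    0 < c.rate Δ η σ → 0 < c.totalRate Δ (patch Δ σ η)

/-- Minimal transition rate: for `c_Δ > 0`, the positive rates in `Δ` are bounded away from `0`. -/
def HasMinimalRate : Prop :=
  ∀ Δ : Finset (Site d), 0 < c.maxRate Δ →
    ∃ m : ℝ, 0 < m ∧ ∀ (η : Config d q) (σ : Δ → Fin q), 0 < c.rate Δ η σ → m ≤ c.rate Δ η σ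

/-- `L f(η) = ∑_Δ ∑_σ c_Δ(η, σ) (f(σ_Δ η_{Δᶜ}) - f(η))`. -/
def generator (f : Config d q → ℝ) (η : Config d q) : ℝ :=
  ∑' Δ : Finset (Site d), ∑ σ : Δ → Fin q, c.rate Δ η σ * (f (patch Δ σ η) - f η)

end JumpRates

/-- Translation-invariant probability measures, with the topology of weak convergence. -/
abbrev InvMeasure (d q : ℕ) : Type :=
  {ν : ProbabilityMeasure (Config d q) //
    ∀ i : Site d, (ν : Measure (Config d q)).map (shift i) = (ν : Measure (Config d q))}

/-- The underlying measure. -/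
def InvMeasure.meas {d q : ℕ} (ν : InvMeasure d q) : Measure (Config d q) :=
  ((ν : ProbabilityMeasure (Config d q)) : Measure (Config d q))

/-- The Lebesgue integral of an extended-real function: integral of the positive part minus
integral of the negative part. -/
def extIntegral {X : Type*} [MeasurableSpace X] (ν : Measure X) (f : X → EReal) : EReal :=
  ((∫⁻ x, (f x).toENNReal ∂ν : ℝ≥0∞) : EReal) - ((∫⁻ x, (-f x).toENNReal ∂ν : ℝ≥0∞) : EReal)

/-- The hypercube `[-r, r]^d` centered at the origin. -/
def cube (d : ℕ) (r : ℤ) : Finset (Site d) := Finset.Icc (fun _ => -r) (fun _ => r)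

variable {d q : ℕ}

/-- `|Λ|⁻¹ ∑_{ω_Λ} ν(L 1_{ω_Λ}) log ν(ω_Λ)`, in `[-∞, ∞]` with `log 0 = -∞` and `0 · (-∞) = 0`. -/
def entropyLossIn (c : JumpRates d q) (ν : InvMeasure d q) (Λ : Finset (Site d)) : EReal :=
  (((Λ.card : ℝ)⁻¹ : ℝ) : EReal) * ∑ ω : Λ → Fin q,
    ((∫ η, c.generator ((localCyl Λ ω).indicator fun _ => 1) η ∂ν.meas : ℝ) : EReal) *
      ENNReal.log (ν.meas (localCyl Λ ω))

/-- `g` is the specific entropy loss `g_L(ν)`: the limit along hypercubes centered at the origin. -/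
def IsSpecificEntropyLoss (c : JumpRates d q) (ν : InvMeasure d q) (g : EReal) : Prop :=
  Tendsto (fun n : ℕ => entropyLossIn c ν (cube d n)) atTop (𝓝 g)

/-- `log (ν(σ_{Δ ∩ Λ} | η_{Λ \ Δ}) / ν(η_{Δ ∩ Λ} | η_{Λ \ Δ}))`, with `log 0 = -∞`. -/
def logRatio (ν : InvMeasure d q) (Λ Δ : Finset (Site d)) (σ : Δ → Fin q) (η : Config d q) :
    EReal :=
  ENNReal.log (cond ν.meas (cyl (Λ \ Δ) η) (cyl (Δ ∩ Λ) (patch Δ σ η)) /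
    cond ν.meas (cyl (Λ \ Δ) η) (cyl (Δ ∩ Λ) η))

/-- The finite-volume approximated specific entropy loss, with `Λ_n = [-2^n+1, 2^n-1]^d` and
summation over the sites of `[-2^n+n+1, 2^n-n-1]^d`. -/
def approxEntropyLoss (c : JumpRates d q) (ν : InvMeasure d q) (n : ℕ) : EReal :=
  ((((cube d (2 ^ n - 1)).card : ℝ)⁻¹ : ℝ) : EReal) *
    ∑ i ∈ cube d (2 ^ n - n - 1), ∑' Δ : {Δ : Finset (Site d) // i ∈ Δ},
      ∑ σ : Δ.1 → Fin q,
        extIntegral ν.meas fun η =>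
          (c.rate Δ.1 η σ : EReal) * (((Δ.1.card : ℝ)⁻¹ : ℝ) : EReal) *
            logRatio ν (cube d (2 ^ n - 1)) Δ.1 σ η

/-- `g` is the approximated specific entropy loss of `ν`. -/
def IsApproxEntropyLoss (c : JumpRates d q) (ν : InvMeasure d q) (g : EReal) : Prop :=
  Tendsto (fun n : ℕ => approxEntropyLoss c ν n) atTop (𝓝 g)

end Attractor

end

/-!
The jumps to `σ` in `Δ`, with rate `f`, contribute `∫ f log (ν((σ_Δ η_{Δᶜ})_Λ) / ν(η_Λ)) dν`
(`jumpLoss`) to the entropy loss in a box `Λ`. Two measures govern this integral: `f ν`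
(`outMass`), and `f ν'` (`inMass`), where `ν'` is the image of `ν` under the reversed jump. If `f`
depended on the coordinates in `Λ ⊇ Δ` only, then the ratio of probabilities would be that of
`inMass` and `outMass`, and the integral would be exactly `massDiff - boxEnt`: a difference of total
masses, which does not depend on `Λ`, minus the relative entropy of `outMass` with respect to
`inMass` in `Λ`. Relative entropy, written by its variational formula as a supremum of linear
functionals (`relEnt`), is subadditive and lower semicontinuous. Hence `boxEnt` increases with `Λ`
(`monotone_boxEnt`), and its supremum over `Λ` is a lower semicontinuous function of `ν`.

For general rates, uniform continuity and the minimal transition rate show that `f` varies on the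
cylinders of a large box only by a factor close to one, and this changes the logarithm of the ratio
by little (`abs_log_mass_sub_le`). So `jumpLoss` converges to `jumpLossLim`, in `[-∞, ∞)`, as the
box grows (`tendsto_jumpLoss`). Null cylinders need no non-nullness assumption: if some jump leads
into a null cylinder with positive probability, both `jumpLoss` and `massDiff - boxEnt` are `-∞`.

By translation invariance the loss attributed to a site `i` in `Λ` is that attributed to the origin
in `Λ - i` (`siteLoss_eq_originLoss`), so that the approximated specific entropy loss is an average
of convergent quantities, with limit `lossDensity`. The entropy loss in a cube is bounded by the sum
of the losses of all sites whose jumps may meet it (`entropyLossIn_le`). The sites near the boundary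
contribute at most a constant each, because `log t ≤ t` (`jumpLoss_le`), which is negligible in the
limit. This gives the inequality.
-/

namespace Attractor

/-! ### The pointwise relative entropy -/

/-- The pointwise relative entropy `y log (y / x) - y + x` of `y` with respect to `x`, with the
values `x` at `y = 0` and `∞` at `x = 0 < y`. It is encoded by its variational formula, as a
supremum of linear functions of `(x, y)`: lower semicontinuity and subadditivity are immediate. -/
noncomputable def relEnt (x y : ℝ) : ℝ≥0∞ :=
  ⨆ t : ℝ, ENNReal.ofReal (t * y - x * (Real.exp t - 1))

theorem relEnt_sum_le {ι : Type*} (s : Finset ι) (x y : ι → ℝ) :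
    relEnt (∑ i ∈ s, x i) (∑ i ∈ s, y i) ≤ ∑ i ∈ s, relEnt (x i) (y i) := by
  refine iSup_le fun t => ?_
  rw [Finset.mul_sum, Finset.sum_mul, ← Finset.sum_sub_distrib]
  refine le_trans (ENNReal.ofReal_le_ofReal
    (Finset.sum_le_sum fun i _ => le_max_left (t * y i - x i * (Real.exp t - 1)) 0)) ?_
  rw [ENNReal.ofReal_sum_of_nonneg fun i _ => le_max_right _ _]
  refine Finset.sum_le_sum fun i _ => ?_
  refine le_trans (le_of_eq ?_)
    (le_iSup (fun t : ℝ => ENNReal.ofReal (t * y i - x i * (Real.exp t - 1))) t)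
  rcases le_total (t * y i - x i * (Real.exp t - 1)) 0 with h | h
  · rw [max_eq_right h, ENNReal.ofReal_of_nonpos h, ENNReal.ofReal_zero]
  · rw [max_eq_left h]

theorem lowerSemicontinuous_relEnt {α : Type*} [TopologicalSpace α] {x y : α → ℝ}
    (hx : Continuous x) (hy : Continuous y) :
    LowerSemicontinuous fun a => relEnt (x a) (y a) :=
  lowerSemicontinuous_iSup fun _ =>
    (ENNReal.continuous_ofReal.comp
      ((continuous_const.mul hy).sub (hx.mul continuous_const))).lowerSemicontinuous

theorem relEnt_zero_left {y : ℝ} (hy : 0 < y) : relEnt 0 y = ⊤ := by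
  refine ENNReal.eq_top_of_forall_nnreal_le fun r => ?_
  refine le_trans (le_of_eq ?_)
    (le_iSup (fun t : ℝ => ENNReal.ofReal (t * y - 0 * (Real.exp t - 1))) (r / y))
  rw [zero_mul, sub_zero, div_mul_cancel₀ _ hy.ne', ENNReal.ofReal_coe_nnreal]

/-- With `Real.log 0 = 0` the formula also holds at `y = 0`. -/
theorem relEnt_eq {x y : ℝ} (hx : 0 ≤ x) (hy : 0 ≤ y) (h : y ≠ 0 → 0 < x) :
    relEnt x y = ENNReal.ofReal (y * (Real.log y - Real.log x) - y + x) := by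
  rcases hy.eq_or_lt with rfl | hy
  · simp only [zero_mul, sub_zero, zero_add]
    refine le_antisymm (iSup_le fun t => ENNReal.ofReal_le_ofReal ?_) ?_
    · nlinarith [Real.exp_pos t]
    · have h1 : Tendsto (fun t : ℝ => ENNReal.ofReal (t * 0 - x * (Real.exp t - 1))) atBot
          (𝓝 (ENNReal.ofReal (0 - x * (0 - 1)))) := by
        refine (ENNReal.continuous_ofReal.tendsto _).comp ?_
        simp only [mul_zero]
        exact tendsto_const_nhds.sub
          (tendsto_const_nhds.mul (Real.tendsto_exp_atBot.sub tendsto_const_nhds))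
      have h2 : (0 : ℝ) - x * (0 - 1) = x := by ring
      rw [h2] at h1
      exact le_of_tendsto' h1 fun t =>
        le_iSup (fun t : ℝ => ENNReal.ofReal (t * 0 - x * (Real.exp t - 1))) t
  · have hx : 0 < x := h hy.ne'
    refine le_antisymm (iSup_le fun t => ENNReal.ofReal_le_ofReal ?_) ?_
    · -- the tangent line of `exp` at the maximiser `log (y / x)`
      have h1 := Real.add_one_le_exp (t - (Real.log y - Real.log x))
      have h2 : Real.exp t = Real.exp (t - (Real.log y - Real.log x)) * (y / x) := by
        rw [← Real.log_div hy.ne' hx.ne', Real.exp_sub, Real.exp_log (div_pos hy hx)]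
        field_simp
      have h3 : x * Real.exp t = Real.exp (t - (Real.log y - Real.log x)) * y := by
        rw [h2]; field_simp
      nlinarith
    · refine le_trans (le_of_eq ?_) (le_iSup (fun t : ℝ =>
        ENNReal.ofReal (t * y - x * (Real.exp t - 1))) (Real.log y - Real.log x))
      congr 1
      rw [← Real.log_div hy.ne' hx.ne', Real.exp_log (div_pos hy hx)]
      field_simp
      ring

theorem relEnt_formula_nonneg {x y : ℝ} (hx : 0 ≤ x) (hy : 0 ≤ y) (h : y ≠ 0 → 0 < x) :
    0 ≤ y * (Real.log y - Real.log x) - y + x := by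
  rcases hy.eq_or_lt with rfl | hy
  · simpa using hx
  · have hx : 0 < x := h hy.ne'
    have h1 := Real.log_le_sub_one_of_pos (div_pos hx hy)
    rw [Real.log_div hx.ne' hy.ne'] at h1
    have h2 : y * (x / y) = x := by field_simp
    nlinarith

/-! ### Extended real numbers and extended integrals -/

theorem tendsto_of_eventually_close {α : Type*} {l : Filter α} {u g : α → EReal} {G : EReal}
    (hg : Tendsto g l (𝓝 G))
    (h : ∀ δ : ℝ, 0 < δ → ∀ᶠ a in l, u a ≤ g a + (δ : EReal) ∧ g a ≤ u a + (δ : EReal)) :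
    Tendsto u l (𝓝 G) := by
  refine tendsto_order.2 ⟨fun a ha => ?_, fun a ha => ?_⟩
  · obtain ⟨r, har, hr⟩ := EReal.lt_iff_exists_real_btwn.1 ha
    obtain ⟨s, hrs, hs⟩ := EReal.lt_iff_exists_real_btwn.1 hr
    have hrs' : r < s := by exact_mod_cast hrs
    filter_upwards [h (s - r) (sub_pos.2 hrs'), hg.eventually (lt_mem_nhds hs)] with b hb hb'
    refine har.trans_le ?_
    by_contra hlt
    push Not at hlt
    have h1 : (s : EReal) < u b + ((s - r : ℝ) : EReal) := hb'.trans_le hb.2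
    have h2 : u b + ((s - r : ℝ) : EReal) ≤ (r : EReal) + ((s - r : ℝ) : EReal) := by gcongr
    rw [← EReal.coe_add, add_sub_cancel] at h2
    exact (h1.trans_le h2).false
  · obtain ⟨r, hr, har⟩ := EReal.lt_iff_exists_real_btwn.1 ha
    obtain ⟨s, hs, hrs⟩ := EReal.lt_iff_exists_real_btwn.1 hr
    have hrs' : s < r := by exact_mod_cast hrs
    filter_upwards [h (r - s) (sub_pos.2 hrs'), hg.eventually (gt_mem_nhds hs)] with b hb hb'
    refine lt_of_le_of_lt hb.1 (lt_of_le_of_lt ?_ har)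
    have h2 : g b + ((r - s : ℝ) : EReal) ≤ (s : EReal) + ((r - s : ℝ) : EReal) := by
      gcongr
    rwa [← EReal.coe_add, add_sub_cancel] at h2

theorem tendsto_sum_of_lt_top {α ι : Type*} {l : Filter α} (s : Finset ι) {u : ι → α → EReal}
    {G : ι → EReal} (hG : ∀ i ∈ s, G i < ⊤) (h : ∀ i ∈ s, Tendsto (u i) l (𝓝 (G i))) :
    ∑ i ∈ s, G i < ⊤ ∧ Tendsto (fun a => ∑ i ∈ s, u i a) l (𝓝 (∑ i ∈ s, G i)) := by
  classical
  induction s using Finset.induction_on with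
  | empty => simpa using tendsto_const_nhds
  | insert i s hi ih =>
    obtain ⟨h1, h2⟩ := ih (fun j hj => hG j (Finset.mem_insert_of_mem hj))
      (fun j hj => h j (Finset.mem_insert_of_mem hj))
    have h3 := hG i (Finset.mem_insert_self _ _)
    simp only [Finset.sum_insert hi]
    refine ⟨EReal.add_lt_top h3.ne h1.ne, ?_⟩
    exact (EReal.continuousAt_add (p := (G i, ∑ i ∈ s, G i)) (Or.inl h3.ne)
      (Or.inr h1.ne)).tendsto.comp
      ((h i (Finset.mem_insert_self _ _)).prodMk_nhds h2)

theorem sum_coe_sub_coe {ι : Type*} (s : Finset ι) (r : ι → ℝ) (k : ι → ℝ≥0∞) :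
    ∑ i ∈ s, ((r i : EReal) - (k i : EReal)) =
      ((∑ i ∈ s, r i : ℝ) : EReal) - ((∑ i ∈ s, k i : ℝ≥0∞) : EReal) := by
  classical
  induction s using Finset.induction_on with
  | empty => simp
  | insert i s hi ih =>
    rw [Finset.sum_insert hi, Finset.sum_insert hi, Finset.sum_insert hi, ih, EReal.coe_add,
      EReal.coe_ennreal_add, sub_eq_add_neg, sub_eq_add_neg, sub_eq_add_neg, EReal.neg_add
        (Or.inl (EReal.coe_ennreal_ne_bot _)) (Or.inr (EReal.coe_ennreal_ne_bot _)), sub_eq_add_neg]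
    exact add_add_add_comm _ _ _ _

theorem sum_eq_bot {ι : Type*} {s : Finset ι} {u : ι → EReal} {i : ι} (hi : i ∈ s)
    (h : u i = ⊥) : ∑ j ∈ s, u j = ⊥ := by
  classical
  rw [← Finset.add_sum_erase s u hi, h, EReal.bot_add]

theorem coe_sum {ι : Type*} (s : Finset ι) (u : ι → ℝ) :
    ((∑ i ∈ s, u i : ℝ) : EReal) = ∑ i ∈ s, (u i : EReal) := by
  classical
  induction s using Finset.induction_on with
  | empty => simp
  | insert i s hi ih => rw [Finset.sum_insert hi, Finset.sum_insert hi, EReal.coe_add, ih]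

section extIntegral

variable {X : Type*} [MeasurableSpace X] {ν : Measure X}

theorem extIntegral_congr_ae {f g : X → EReal} (h : f =ᵐ[ν] g) :
    extIntegral ν f = extIntegral ν g := by
  unfold extIntegral
  congr 2
  · exact lintegral_congr_ae (h.mono fun x hx => by simp only [hx])
  · exact lintegral_congr_ae (h.mono fun x hx => by simp only [hx])

theorem extIntegral_coe {u : X → ℝ} (hu : Integrable u ν) :
    extIntegral ν (fun x => (u x : EReal)) = ((∫ x, u x ∂ν : ℝ) : EReal) := by
  unfold extIntegral
  have h1 : ∫⁻ x, ENNReal.ofReal (u x) ∂ν ≠ ⊤ := hu.lintegral_lt_top.ne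
  have h2 : ∫⁻ x, ENNReal.ofReal (-u x) ∂ν ≠ ⊤ := hu.neg.lintegral_lt_top.ne
  simp only [← EReal.coe_neg, EReal.real_coe_toENNReal]
  rw [integral_eq_lintegral_pos_part_sub_lintegral_neg_part hu, EReal.coe_sub,
    EReal.coe_ennreal_toReal h1, EReal.coe_ennreal_toReal h2]

theorem extIntegral_eq_bot {f : X → EReal} {s : Set X} (hs : MeasurableSet s) (h0 : ν s ≠ 0)
    (h : ∀ x ∈ s, f x = ⊥) : extIntegral ν f = ⊥ := by
  have h1 : ∫⁻ x, (-f x).toENNReal ∂ν = ⊤ := by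
    refine top_le_iff.1 (le_trans (le_of_eq ?_)
      (lintegral_mono (f := s.indicator fun _ => (⊤ : ℝ≥0∞)) fun x => ?_))
    · rw [lintegral_indicator_const hs, ENNReal.top_mul h0]
    · by_cases hx : x ∈ s
      · simp [hx, h x hx]
      · simp [hx]
  rw [extIntegral, h1, EReal.coe_ennreal_top, EReal.sub_top]

theorem extIntegral_map_equiv {Y : Type*} [MeasurableSpace Y] (e : X ≃ᵐ Y) (f : Y → EReal) :
    extIntegral (ν.map e) f = extIntegral ν fun x => f (e x) := by
  unfold extIntegral
  rw [lintegral_map_equiv, lintegral_map_equiv]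

end extIntegral

/-! ### Local configurations -/

section Local

variable {d q : ℕ}

/-- The restriction of a configuration to a finite box. -/
def restr (Λ : Finset (Site d)) (η : Config d q) : Λ → Fin q := fun x => η x

/-- The effect on the box `Λ` of a jump to `σ` in `Δ`. -/
def patchIn (Λ Δ : Finset (Site d)) (σ : Δ → Fin q) (ω : Λ → Fin q) : Λ → Fin q :=
  fun x => if h : x.1 ∈ Δ then σ ⟨x, h⟩ else ω x

theorem restr_patch (Λ Δ : Finset (Site d)) (σ : Δ → Fin q) (η : Config d q) :
    restr Λ (patch Δ σ η) = patchIn Λ Δ σ (restr Λ η) := rfl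

theorem mem_localCyl {Λ : Finset (Site d)} {ω : Λ → Fin q} {ξ : Config d q} :
    ξ ∈ localCyl Λ ω ↔ restr Λ ξ = ω :=
  ⟨fun h => funext h, fun h x => congrFun h x⟩

theorem cyl_eq_localCyl (Λ : Finset (Site d)) (η : Config d q) :
    cyl Λ η = localCyl Λ (restr Λ η) :=
  Set.ext fun _ => ⟨fun h x => h x x.2, fun h x hx => h ⟨x, hx⟩⟩

theorem continuous_restr (Λ : Finset (Site d)) :
    Continuous (restr Λ : Config d q → Λ → Fin q) :=
  continuous_pi fun x => continuous_apply x.1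

theorem isClopen_localCyl (Λ : Finset (Site d)) (ω : Λ → Fin q) : IsClopen (localCyl Λ ω) := by
  have h : localCyl Λ ω = restr Λ ⁻¹' {ω} := Set.ext fun _ => mem_localCyl
  rw [h]
  exact (isClopen_discrete {ω}).preimage (continuous_restr Λ)

theorem measurableSet_localCyl (Λ : Finset (Site d)) (ω : Λ → Fin q) :
    MeasurableSet (localCyl Λ ω) := (isClopen_localCyl Λ ω).1.measurableSet

theorem continuous_patch (Δ : Finset (Site d)) (σ : Δ → Fin q) :
    Continuous (patch Δ σ : Config d q → Config d q) := by
  refine continuous_pi fun x => ?_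
  by_cases h : x ∈ Δ
  · simpa only [patch, h, dif_pos] using continuous_const
  · simpa only [patch, h, dif_neg, not_false_eq_true] using continuous_apply x

theorem continuous_localCyl_indicator (Λ : Finset (Site d)) (ω : Λ → Fin q)
    {f : Config d q → ℝ} (hf : Continuous f) : Continuous ((localCyl Λ ω).indicator f) :=
  hf.indicator fun x hx => by simp [(isClopen_localCyl Λ ω).frontier_eq] at hx

theorem sum_localCyl_indicator (Λ : Finset (Site d)) (P : (Λ → Fin q) → Prop) [DecidablePred P]
    (f : Config d q → ℝ) (η : Config d q) :
    ∑ ω with P ω, (localCyl Λ ω).indicator f η = if P (restr Λ η) then f η else 0 := by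
  have h (ω : Λ → Fin q) : (localCyl Λ ω).indicator f η = if restr Λ η = ω then f η else 0 := by
    classical
    rw [Set.indicator_apply]
    simp only [mem_localCyl]
  simp only [h]
  rw [Finset.sum_ite_eq]
  simp

theorem integrable_of_continuous {f : Config d q → ℝ} (hf : Continuous f)
    (ν : Measure (Config d q)) [IsFiniteMeasure ν] : Integrable f ν :=
  hf.integrable_of_hasCompactSupport (HasCompactSupport.of_compactSpace f)

theorem integral_mul_restr (ν : Measure (Config d q)) [IsFiniteMeasure ν] (Λ : Finset (Site d))
    {f : Config d q → ℝ} (hf : Continuous f) (g : (Λ → Fin q) → ℝ) :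
    ∫ η, f η * g (restr Λ η) ∂ν = ∑ ω, (∫ η, (localCyl Λ ω).indicator f η ∂ν) * g ω := by
  simp only [← integral_mul_const]
  rw [← integral_finsetSum _ fun ω _ =>
    (integrable_of_continuous (continuous_localCyl_indicator Λ ω hf) ν).mul_const _]
  refine integral_congr_ae (ae_of_all _ fun η => ?_)
  dsimp only
  rw [Finset.sum_eq_single (restr Λ η), Set.indicator_of_mem (mem_localCyl.2 rfl)]
  · intro ω _ h
    rw [Set.indicator_of_notMem fun h' => h (mem_localCyl.1 h').symm, zero_mul]
  · simp

theorem sum_measureReal_localCyl (ν : Measure (Config d q)) [IsProbabilityMeasure ν]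
    (Λ : Finset (Site d)) : ∑ ω, ν.real (localCyl Λ ω) = 1 := by
  have h := integral_mul_restr ν Λ (f := fun _ => 1) continuous_const fun _ => 1
  simp only [mul_one, integral_const, probReal_univ, smul_eq_mul] at h
  rw [h]
  exact Finset.sum_congr rfl fun ω _ =>
    (integral_indicator_one (measurableSet_localCyl Λ ω)).symm

theorem ae_measure_cyl_ne_zero (ν : Measure (Config d q)) (Λ : Finset (Site d)) :
    ∀ᵐ η ∂ν, ν (cyl Λ η) ≠ 0 := by
  have h : ∀ᵐ η ∂ν, ∀ ω, ν (localCyl Λ ω) = 0 → η ∉ localCyl Λ ω := by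
    refine ae_all_iff.2 fun ω => ?_
    by_cases h0 : ν (localCyl Λ ω) = 0
    · filter_upwards [measure_eq_zero_iff_ae_notMem.1 h0] with η hη _ using hη
    · exact ae_of_all _ fun η h => absurd h h0
  filter_upwards [h] with η hη h0
  rw [cyl_eq_localCyl] at h0
  exact hη _ h0 (mem_localCyl.2 rfl)

/-- At most `q ^ |Δ|` configurations in `Λ` are mapped to a given one by a jump in `Δ`. -/
theorem sum_measureReal_patchIn_le (ν : Measure (Config d q)) [IsProbabilityMeasure ν]
    (Λ Δ : Finset (Site d)) (σ : Δ → Fin q) :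
    ∑ ω, ν.real (localCyl Λ (patchIn Λ Δ σ ω)) ≤ Fintype.card (Δ → Fin q) := by
  rw [Finset.sum_comp (fun τ => ν.real (localCyl Λ τ)) (patchIn Λ Δ σ)]
  calc _ ≤ ∑ τ ∈ Finset.univ.image (patchIn Λ Δ σ),
        (Fintype.card (Δ → Fin q) : ℝ) * ν.real (localCyl Λ τ) := by
        refine Finset.sum_le_sum fun τ _ => ?_
        rw [nsmul_eq_mul]
        refine mul_le_mul_of_nonneg_right (Nat.cast_le.2 ?_) measureReal_nonneg
        rw [← Finset.card_univ]
        refine Finset.card_le_card_of_injOn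
          (fun ω x => if h : x.1 ∈ Λ then ω ⟨x, h⟩ else σ x) (fun _ _ => Finset.mem_univ _) ?_
        intro ω hω ω' hω' heq
        have h1 : patchIn Λ Δ σ ω = patchIn Λ Δ σ ω' := by
          rw [(Finset.mem_filter.1 hω).2, (Finset.mem_filter.1 hω').2]
        funext x
        by_cases hx : x.1 ∈ Δ
        · simpa using congrFun heq ⟨x.1, hx⟩
        · simpa [patchIn, hx] using congrFun h1 x
    _ ≤ ∑ τ, (Fintype.card (Δ → Fin q) : ℝ) * ν.real (localCyl Λ τ) :=
        Finset.sum_le_sum_of_subset_of_nonneg (Finset.subset_univ _)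
          fun _ _ _ => mul_nonneg (Nat.cast_nonneg _) measureReal_nonneg
    _ = _ := by rw [← Finset.mul_sum, sum_measureReal_localCyl, mul_one]

end Local

/-! ### The transpose of a jump -/

section Transpose

variable {d q : ℕ}

/-- The transpose of the jump `η ↦ σ_Δ η_{Δᶜ}`: at a configuration `ξ` that equals `σ` on `Δ`, the
sum of `f` over all configurations from which the jump leads to `ξ`. -/
noncomputable def transpose (Δ : Finset (Site d)) (σ : Δ → Fin q) (f : Config d q → ℝ)
    (ξ : Config d q) : ℝ :=
  ∑ a : Δ → Fin q, (localCyl Δ σ).indicator (fun ξ => f (patch Δ a ξ)) ξ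

theorem continuous_transpose (Δ : Finset (Site d)) (σ : Δ → Fin q) {f : Config d q → ℝ}
    (hf : Continuous f) : Continuous (transpose Δ σ f) :=
  continuous_finsetSum _ fun a _ =>
    continuous_localCyl_indicator Δ σ (hf.comp (continuous_patch Δ a))

theorem transpose_sum {ι : Type*} (s : Finset ι) (Δ : Finset (Site d)) (σ : Δ → Fin q)
    (f : ι → Config d q → ℝ) (ξ : Config d q) :
    transpose Δ σ (fun η => ∑ i ∈ s, f i η) ξ = ∑ i ∈ s, transpose Δ σ (f i) ξ := by
  unfold transpose
  rw [Finset.sum_comm]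
  refine Finset.sum_congr rfl fun a _ => ?_
  by_cases h : ξ ∈ localCyl Δ σ <;> simp [h]

theorem transpose_localCyl_indicator {Λ Δ : Finset (Site d)} (hΔ : Δ ⊆ Λ) (σ : Δ → Fin q)
    (ω : Λ → Fin q) (f : Config d q → ℝ) (ξ : Config d q) :
    transpose Δ σ ((localCyl Λ ω).indicator f) ξ =
      (localCyl Λ (patchIn Λ Δ σ ω)).indicator
        (fun ξ => (localCyl Λ ω).indicator f (patch Δ (fun x => ω ⟨x, hΔ x.2⟩) ξ)) ξ := by
  unfold transpose
  rw [Finset.sum_eq_single fun x : Δ => ω ⟨x, hΔ x.2⟩]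
  · by_cases h1 : ξ ∈ localCyl Λ (patchIn Λ Δ σ ω)
    · have h2 : ξ ∈ localCyl Δ σ := fun x => by
        simpa [patchIn] using h1 ⟨x, hΔ x.2⟩
      rw [Set.indicator_of_mem h1, Set.indicator_of_mem h2]
    · rw [Set.indicator_of_notMem h1, Set.indicator_apply_eq_zero]
      intro h2
      refine Set.indicator_of_notMem (fun h3 => h1 fun x => ?_) _
      by_cases hx : x.1 ∈ Δ
      · simpa [patchIn, hx] using h2 ⟨x, hx⟩
      · simpa [patchIn, patch, hx] using h3 x
  · intro a _ ha
    rw [Set.indicator_apply_eq_zero]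
    intro _
    refine Set.indicator_of_notMem (fun h3 => ha (funext fun x => ?_)) _
    simpa [patch] using h3 ⟨x, hΔ x.2⟩
  · simp

theorem patch_mem_localCyl {Λ Δ : Finset (Site d)} (hΔ : Δ ⊆ Λ) {σ : Δ → Fin q}
    {ω : Λ → Fin q} {ξ : Config d q} (h : ξ ∈ localCyl Λ (patchIn Λ Δ σ ω)) :
    patch Δ (fun x => ω ⟨x, hΔ x.2⟩) ξ ∈ localCyl Λ ω := fun x => by
  by_cases hx : x.1 ∈ Δ
  · simp [patch, hx]
  · simpa [patch, patchIn, hx] using h x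

end Transpose

section Jump

variable {d q : ℕ}

/-! ### The entropy loss of a single jump -/

/-- `∫ f(η) log (ν((σ_Δ η_{Δᶜ})_Λ) / ν(η_Λ)) ν(dη)`: the entropy loss in `Λ` due to the jumps to
`σ` in `Δ` with rate `f`. -/
noncomputable def jumpLoss (ν : Measure (Config d q)) (f : Config d q → ℝ)
    (Λ Δ : Finset (Site d)) (σ : Δ → Fin q) : EReal :=
  extIntegral ν fun η => (f η : EReal) *
    ENNReal.log (ν (cyl Λ (patch Δ σ η)) / ν (cyl Λ η))

/-- The mass that the measure `f ν` gives to a cylinder. -/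
noncomputable def outMass (ν : Measure (Config d q)) (f : Config d q → ℝ) (Λ : Finset (Site d))
    (ω : Λ → Fin q) : ℝ := ∫ η, (localCyl Λ ω).indicator f η ∂ν

/-- The mass of a cylinder under the measure `f ν'`, where `ν'` is the image of `ν` under the
reversed jump, which replaces `σ` on `Δ` by every possible local configuration. -/
noncomputable def inMass (ν : Measure (Config d q)) (f : Config d q → ℝ) (Λ Δ : Finset (Site d))
    (σ : Δ → Fin q) (ω : Λ → Fin q) : ℝ :=
  ∫ ξ, transpose Δ σ ((localCyl Λ ω).indicator f) ξ ∂ν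

/-- The relative entropy in the box `Λ` of the measure `outMass` with respect to `inMass`. -/
noncomputable def boxEnt (ν : Measure (Config d q)) (f : Config d q → ℝ) (Δ : Finset (Site d))
    (σ : Δ → Fin q) (Λ : Finset (Site d)) : ℝ≥0∞ :=
  ∑ ω, relEnt (inMass ν f Λ Δ σ ω) (outMass ν f Λ ω)

/-- The difference of the total masses of `inMass` and `outMass`. -/
noncomputable def massDiff (ν : Measure (Config d q)) (f : Config d q → ℝ) (Δ : Finset (Site d))
    (σ : Δ → Fin q) : ℝ := ∫ ξ, transpose Δ σ f ξ ∂ν - ∫ η, f η ∂ν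

/-- On configurations that agree on `Λ`, the function `f` varies at most by a factor `1 + δ`. -/
def RatioClose (f : Config d q → ℝ) (Λ : Finset (Site d)) (δ : ℝ) : Prop :=
  ∀ η ξ, restr Λ η = restr Λ ξ → f ξ ≤ (1 + δ) * f η

variable {ν : Measure (Config d q)} {f : Config d q → ℝ}

theorem outMass_nonneg (h0 : 0 ≤ f) (Λ : Finset (Site d)) (ω : Λ → Fin q) :
    0 ≤ outMass ν f Λ ω :=
  integral_nonneg fun η => Set.indicator_nonneg (fun η _ => h0 η) η

theorem transpose_nonneg {g : Config d q → ℝ} (h0 : 0 ≤ g) (Δ : Finset (Site d))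
    (σ : Δ → Fin q) : 0 ≤ transpose Δ σ g := fun ξ =>
  Finset.sum_nonneg fun _ _ => Set.indicator_nonneg (fun _ _ => h0 _) ξ

theorem inMass_nonneg (h0 : 0 ≤ f) (Λ Δ : Finset (Site d)) (σ : Δ → Fin q) (ω : Λ → Fin q) :
    0 ≤ inMass ν f Λ Δ σ ω :=
  integral_nonneg (transpose_nonneg
    (fun η => Set.indicator_nonneg (fun η _ => h0 η) η) Δ σ)

/-- For `Δ ⊆ Λ`, the mass `inMass` of a cylinder is that of its image under the jump, for a
density with values of `f` on the cylinder itself. -/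
theorem exists_inMass_eq {Λ Δ : Finset (Site d)} (hΔ : Δ ⊆ Λ) (hf : Continuous f) (σ : Δ → Fin q)
    (ω : Λ → Fin q) : ∃ g : Config d q → ℝ, Continuous g ∧
      inMass ν f Λ Δ σ ω = outMass ν g Λ (patchIn Λ Δ σ ω) ∧
      ∀ ξ ∈ localCyl Λ (patchIn Λ Δ σ ω), ∃ η ∈ localCyl Λ ω, g ξ = f η := by
  refine ⟨fun ξ => (localCyl Λ ω).indicator f (patch Δ (fun x => ω ⟨x, hΔ x.2⟩) ξ),
    (continuous_localCyl_indicator Λ ω hf).comp (continuous_patch _ _), ?_, fun ξ hξ => ?_⟩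
  · unfold inMass outMass
    simp only [transpose_localCyl_indicator hΔ]
  · exact ⟨_, patch_mem_localCyl hΔ hξ, Set.indicator_of_mem (patch_mem_localCyl hΔ hξ) _⟩

theorem jumpLoss_eq_bot (hf : Continuous f) (h0 : 0 ≤ f) {Λ Δ : Finset (Site d)} {σ : Δ → Fin q}
    (h : ¬ ∀ᵐ η ∂ν, ν (cyl Λ (patch Δ σ η)) = 0 → f η = 0) : jumpLoss ν f Λ Δ σ = ⊥ := by
  have hm : MeasurableSet {η | ¬ (ν (cyl Λ (patch Δ σ η)) = 0 → f η = 0)} := by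
    have h1 : {η | ¬ (ν (cyl Λ (patch Δ σ η)) = 0 → f η = 0)} =
        restr Λ ⁻¹' {ω | ν (localCyl Λ (patchIn Λ Δ σ ω)) = 0} ∩ {η | f η ≠ 0} := by
      ext η
      simp [cyl_eq_localCyl, restr_patch]
    rw [h1]
    exact ((isOpen_discrete _).preimage (continuous_restr Λ)).measurableSet.inter
      (isOpen_ne_fun hf continuous_const).measurableSet
  refine extIntegral_eq_bot hm (fun h1 => h (ae_iff.2 h1)) fun η hη => ?_
  simp only [Set.mem_ofPred_eq, Classical.not_imp] at hη
  rw [hη.1, ENNReal.zero_div, ENNReal.log_zero]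
  exact EReal.coe_mul_bot_of_pos (lt_of_le_of_ne (h0 η) (Ne.symm hη.2))

theorem log_div_toReal {x y : ℝ≥0∞} (hx : x ≠ 0) (hx' : x ≠ ⊤) (hy : y ≠ 0) (hy' : y ≠ ⊤) :
    ENNReal.log (x / y) = ((Real.log x.toReal - Real.log y.toReal : ℝ) : EReal) := by
  rw [ENNReal.log_pos_real (ENNReal.div_ne_zero.2 ⟨hx, hy'⟩) (ENNReal.div_ne_top hx' hy),
    ENNReal.toReal_div, Real.log_div (ENNReal.toReal_ne_zero.2 ⟨hx, hx'⟩)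
      (ENNReal.toReal_ne_zero.2 ⟨hy, hy'⟩)]

variable [IsProbabilityMeasure ν]

theorem integrable_localCyl_indicator (hf : Continuous f) (Λ : Finset (Site d)) (ω : Λ → Fin q) :
    Integrable ((localCyl Λ ω).indicator f) ν :=
  integrable_of_continuous (continuous_localCyl_indicator Λ ω hf) ν

theorem sum_outMass (hf : Continuous f) (Λ : Finset (Site d)) (P : (Λ → Fin q) → Prop)
    [DecidablePred P] : ∑ ω with P ω, outMass ν f Λ ω =
      ∫ η, (if P (restr Λ η) then f η else 0) ∂ν := by
  unfold outMass
  rw [← integral_finsetSum _ fun ω _ => integrable_localCyl_indicator hf Λ ω]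
  simp only [sum_localCyl_indicator]

theorem sum_inMass (hf : Continuous f) (Λ Δ : Finset (Site d)) (σ : Δ → Fin q)
    (P : (Λ → Fin q) → Prop) [DecidablePred P] : ∑ ω with P ω, inMass ν f Λ Δ σ ω =
      ∫ ξ, transpose Δ σ (fun η => if P (restr Λ η) then f η else 0) ξ ∂ν := by
  unfold inMass
  rw [← integral_finsetSum _ fun ω _ => integrable_of_continuous
    (continuous_transpose Δ σ (continuous_localCyl_indicator Λ ω hf)) ν]
  simp only [← transpose_sum, sum_localCyl_indicator]

/-- Refining the box increases the relative entropy, because `relEnt` is subadditive. -/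
theorem monotone_boxEnt (hf : Continuous f) (Δ : Finset (Site d)) (σ : Δ → Fin q) :
    Monotone (boxEnt ν f Δ σ) := by
  classical
  intro Λ Λ' hΛ
  have hΛ : Λ ⊆ Λ' := hΛ
  unfold boxEnt
  rw [← Finset.sum_fiberwise (s := Finset.univ)
    (g := fun (ω' : Λ' → Fin q) (x : Λ) => ω' ⟨x, hΛ x.2⟩)]
  refine Finset.sum_le_sum fun ω _ => ?_
  refine le_trans (le_of_eq ?_) (relEnt_sum_le _ _ _)
  have h (η : Config d q) : (if (fun x : Λ => restr Λ' η ⟨x, hΛ x.2⟩) = ω then f η else 0) =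
      (localCyl Λ ω).indicator f η := by
    rw [Set.indicator_apply]
    simp only [mem_localCyl]
    rfl
  rw [sum_outMass hf Λ' fun ω' => (fun x : Λ => ω' ⟨x, hΛ x.2⟩) = ω,
    sum_inMass hf Λ' Δ σ fun ω' => (fun x : Λ => ω' ⟨x, hΛ x.2⟩) = ω]
  simp only [h]
  rfl

theorem outMass_le {Λ : Finset (Site d)} {ω : Λ → Fin q} {B : ℝ} (hf : Continuous f)
    (h : ∀ η ∈ localCyl Λ ω, f η ≤ B) : outMass ν f Λ ω ≤ B * ν.real (localCyl Λ ω) := by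
  have h1 : ∫ η, (localCyl Λ ω).indicator (fun _ => B) η ∂ν = B * ν.real (localCyl Λ ω) := by
    rw [integral_indicator_const _ (measurableSet_localCyl Λ ω), smul_eq_mul, mul_comm]
  rw [← h1]
  refine integral_mono (integrable_localCyl_indicator hf Λ ω)
    (integrable_localCyl_indicator continuous_const Λ ω) fun η => ?_
  exact Set.indicator_le_indicator' (h η)

theorem le_outMass {Λ : Finset (Site d)} {ω : Λ → Fin q} {B : ℝ} (hf : Continuous f)
    (h : ∀ η ∈ localCyl Λ ω, B ≤ f η) : B * ν.real (localCyl Λ ω) ≤ outMass ν f Λ ω := by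
  have h1 := outMass_le (ν := ν) (Λ := Λ) (ω := ω) (f := fun η => -f η) (B := -B) hf.neg
    fun η hη => neg_le_neg (h η hη)
  have h2 : outMass ν (fun η => -f η) Λ ω = -outMass ν f Λ ω := by
    unfold outMass
    rw [← integral_neg]
    refine integral_congr_ae (ae_of_all _ fun η => ?_)
    by_cases hη : η ∈ localCyl Λ ω <;> simp [hη]
  rw [h2] at h1
  linarith

theorem inMass_le {Λ Δ : Finset (Site d)} (hΔ : Δ ⊆ Λ) {σ : Δ → Fin q} {ω : Λ → Fin q} {B : ℝ}
    (hf : Continuous f) (h : ∀ η ∈ localCyl Λ ω, f η ≤ B) :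
    inMass ν f Λ Δ σ ω ≤ B * ν.real (localCyl Λ (patchIn Λ Δ σ ω)) := by
  obtain ⟨g, hg, h1, h2⟩ := exists_inMass_eq (ν := ν) hΔ hf σ ω
  rw [h1]
  refine outMass_le hg fun ξ hξ => ?_
  obtain ⟨η, hη, h3⟩ := h2 ξ hξ
  exact h3.trans_le (h η hη)

theorem le_inMass {Λ Δ : Finset (Site d)} (hΔ : Δ ⊆ Λ) {σ : Δ → Fin q} {ω : Λ → Fin q} {B : ℝ}
    (hf : Continuous f) (h : ∀ η ∈ localCyl Λ ω, B ≤ f η) :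
    B * ν.real (localCyl Λ (patchIn Λ Δ σ ω)) ≤ inMass ν f Λ Δ σ ω := by
  obtain ⟨g, hg, h1, h2⟩ := exists_inMass_eq (ν := ν) hΔ hf σ ω
  rw [h1]
  refine le_outMass hg fun ξ hξ => ?_
  obtain ⟨η, hη, h3⟩ := h2 ξ hξ
  exact (h η hη).trans_eq h3.symm

/-- Two forms of the statement that almost surely no jump leads into a null cylinder. -/
theorem ae_no_null_jump_iff (hf : Continuous f) (h0 : 0 ≤ f) (Λ Δ : Finset (Site d))
    (σ : Δ → Fin q) :
    (∀ᵐ η ∂ν, ν (cyl Λ (patch Δ σ η)) = 0 → f η = 0) ↔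
      ∀ ω, ν.real (localCyl Λ (patchIn Λ Δ σ ω)) = 0 → outMass ν f Λ ω = 0 := by
  have key (ω : Λ → Fin q) : outMass ν f Λ ω = 0 ↔ ∀ᵐ η ∂ν, η ∈ localCyl Λ ω → f η = 0 := by
    unfold outMass
    rw [integral_eq_zero_iff_of_nonneg
      (fun η => Set.indicator_nonneg (fun η _ => h0 η) η) (integrable_localCyl_indicator hf Λ ω)]
    refine eventually_congr (ae_of_all _ fun η => ?_)
    simp only [Pi.zero_apply, Set.indicator_apply_eq_zero]
  simp only [key]
  refine ⟨fun h ω hω => ?_, fun h => ?_⟩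
  · filter_upwards [h] with η hη hmem
    refine hη ?_
    rw [cyl_eq_localCyl, restr_patch, mem_localCyl.1 hmem]
    exact (measureReal_eq_zero_iff (measure_ne_top _ _)).1 hω
  · have h1 : ∀ᵐ η ∂ν, ∀ ω, ν.real (localCyl Λ (patchIn Λ Δ σ ω)) = 0 →
        η ∈ localCyl Λ ω → f η = 0 := by
      refine ae_all_iff.2 fun ω => ?_
      by_cases hω : ν.real (localCyl Λ (patchIn Λ Δ σ ω)) = 0
      · filter_upwards [h ω hω] with η hη _ using hη
      · exact ae_of_all _ fun η hc => absurd hc hω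
    filter_upwards [h1] with η hη hnull
    rw [cyl_eq_localCyl, restr_patch] at hnull
    exact hη _ ((measureReal_eq_zero_iff (measure_ne_top _ _)).2 hnull) (mem_localCyl.2 rfl)

theorem jumpLoss_eq_integral (hf : Continuous f) {Λ Δ : Finset (Site d)} {σ : Δ → Fin q}
    (h : ∀ᵐ η ∂ν, ν (cyl Λ (patch Δ σ η)) = 0 → f η = 0) :
    jumpLoss ν f Λ Δ σ = ((∫ η, f η * (Real.log (ν.real (cyl Λ (patch Δ σ η))) -
      Real.log (ν.real (cyl Λ η))) ∂ν : ℝ) : EReal) := by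
  unfold jumpLoss
  rw [← extIntegral_coe]
  · refine extIntegral_congr_ae ?_
    filter_upwards [h, ae_measure_cyl_ne_zero ν Λ] with η h1 h2
    by_cases hη : f η = 0
    · simp [hη]
    · rw [log_div_toReal (fun h3 => hη (h1 h3)) (measure_ne_top _ _) h2 (measure_ne_top _ _)]
      exact (EReal.coe_mul _ _).symm
  · refine integrable_of_continuous (hf.mul ?_) ν
    simp only [cyl_eq_localCyl, restr_patch]
    exact (continuous_of_discreteTopology (f := fun ω => Real.log (ν.real (localCyl Λ
      (patchIn Λ Δ σ ω))) - Real.log (ν.real (localCyl Λ ω)))).comp (continuous_restr Λ)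

theorem jumpLoss_eq_sum (hf : Continuous f) {Λ Δ : Finset (Site d)} {σ : Δ → Fin q}
    (h : ∀ᵐ η ∂ν, ν (cyl Λ (patch Δ σ η)) = 0 → f η = 0) :
    jumpLoss ν f Λ Δ σ = ((∑ ω, outMass ν f Λ ω *
      (Real.log (ν.real (localCyl Λ (patchIn Λ Δ σ ω))) -
        Real.log (ν.real (localCyl Λ ω))) : ℝ) : EReal) := by
  rw [jumpLoss_eq_integral hf h]
  simp only [cyl_eq_localCyl, restr_patch]
  rw [integral_mul_restr ν Λ hf fun ω => Real.log (ν.real (localCyl Λ (patchIn Λ Δ σ ω))) -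
    Real.log (ν.real (localCyl Λ ω))]
  rfl

/-- A bound uniform in the box, from `log t ≤ t`. -/
theorem jumpLoss_le (hf : Continuous f) (h0 : 0 ≤ f) {B : ℝ} (hB : ∀ η, f η ≤ B)
    (Λ Δ : Finset (Site d)) (σ : Δ → Fin q) :
    jumpLoss ν f Λ Δ σ ≤ ((B * Fintype.card (Δ → Fin q) : ℝ) : EReal) := by
  by_cases h : ∀ᵐ η ∂ν, ν (cyl Λ (patch Δ σ η)) = 0 → f η = 0
  swap
  · rw [jumpLoss_eq_bot hf h0 h]
    exact bot_le
  rw [jumpLoss_eq_sum hf h, EReal.coe_le_coe_iff]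
  obtain ⟨η₀⟩ : Nonempty (Config d q) := nonempty_of_isProbabilityMeasure ν
  have hB0 : 0 ≤ B := (h0 η₀).trans (hB η₀)
  refine le_trans (Finset.sum_le_sum (g := fun ω =>
    B * ν.real (localCyl Λ (patchIn Λ Δ σ ω))) fun ω _ => ?_) ?_
  · have hw := outMass_nonneg (ν := ν) h0 Λ ω
    have hwB := outMass_le (ν := ν) (Λ := Λ) (ω := ω) hf fun η _ => hB η
    have hx0 : 0 ≤ ν.real (localCyl Λ (patchIn Λ Δ σ ω)) := measureReal_nonneg
    have hy0 : 0 ≤ ν.real (localCyl Λ ω) := measureReal_nonneg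
    have hx := (ae_no_null_jump_iff hf h0 Λ Δ σ).1 h ω
    rcases hw.eq_or_lt with hw | hw
    · rw [← hw, zero_mul]
      exact mul_nonneg hB0 hx0
    · have hx1 := lt_of_le_of_ne hx0 fun h1 => hw.ne' (hx h1.symm)
      have hy1 : 0 < ν.real (localCyl Λ ω) := by
        refine lt_of_le_of_ne hy0 fun h1 => ?_
        rw [← h1, mul_zero] at hwB
        exact hwB.not_gt hw
      rw [← Real.log_div hx1.ne' hy1.ne']
      have h1 := Real.log_le_sub_one_of_pos (div_pos hx1 hy1)
      calc _ ≤ outMass ν f Λ ω * (ν.real (localCyl Λ (patchIn Λ Δ σ ω)) / ν.real (localCyl Λ ω)) :=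
            mul_le_mul_of_nonneg_left (by linarith) hw.le
        _ ≤ B * ν.real (localCyl Λ ω) *
            (ν.real (localCyl Λ (patchIn Λ Δ σ ω)) / ν.real (localCyl Λ ω)) :=
            mul_le_mul_of_nonneg_right hwB (div_nonneg hx0 hy0)
        _ = _ := by field_simp
  · rw [← Finset.mul_sum]
    exact mul_le_mul_of_nonneg_left (sum_measureReal_patchIn_le ν Λ Δ σ) hB0

/-- The logarithms of `inMass / outMass` and of the ratio of the probabilities of the cylinders
are close when `f` is nearly constant on cylinders. -/
theorem abs_log_mass_sub_le {Λ Δ : Finset (Site d)} (hΔ : Δ ⊆ Λ) {σ : Δ → Fin q} {δ : ℝ}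
    (hδ : 0 ≤ δ) (hf : Continuous f) (h0 : 0 ≤ f) (hr : RatioClose f Λ δ) {ω : Λ → Fin q}
    (hw : 0 < outMass ν f Λ ω) (hx : 0 < ν.real (localCyl Λ (patchIn Λ Δ σ ω))) :
    0 < inMass ν f Λ Δ σ ω ∧
    |(Real.log (ν.real (localCyl Λ (patchIn Λ Δ σ ω))) - Real.log (ν.real (localCyl Λ ω))) -
      (Real.log (inMass ν f Λ Δ σ ω) - Real.log (outMass ν f Λ ω))| ≤ 2 * δ := by
  obtain ⟨η, hη⟩ : (localCyl Λ ω).Nonempty := by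
    by_contra h
    rw [Set.not_nonempty_iff_eq_empty] at h
    simp [outMass, h] at hw
  have hc (ζ) (hζ : ζ ∈ localCyl Λ ω) : restr Λ η = restr Λ ζ := by
    rw [mem_localCyl.1 hη, mem_localCyl.1 hζ]
  have hd : 0 < 1 + δ := by linarith
  have up (ζ) (hζ : ζ ∈ localCyl Λ ω) : f ζ ≤ (1 + δ) * f η := hr η ζ (hc ζ hζ)
  have lo (ζ) (hζ : ζ ∈ localCyl Λ ω) : f η / (1 + δ) ≤ f ζ := by
    rw [div_le_iff₀' hd]
    exact hr ζ η (hc ζ hζ).symm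
  have w1 := outMass_le (ν := ν) hf up
  have w2 := le_outMass (ν := ν) hf lo
  have v1 := inMass_le (ν := ν) (σ := σ) hΔ hf up
  have v2 := le_inMass (ν := ν) (σ := σ) hΔ hf lo
  have hfη : 0 < f η := by
    refine lt_of_le_of_ne (h0 η) fun h => ?_
    rw [← h, mul_zero, zero_mul] at w1
    exact w1.not_gt hw
  have hy : 0 < ν.real (localCyl Λ ω) := by
    refine lt_of_le_of_ne measureReal_nonneg fun h => ?_
    rw [← h, mul_zero] at w1
    exact w1.not_gt hw
  have hv : 0 < inMass ν f Λ Δ σ ω := lt_of_lt_of_le (by positivity) v2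
  refine ⟨hv, ?_⟩
  have hlog : Real.log (1 + δ) ≤ δ := by
    have := Real.log_le_sub_one_of_pos hd
    linarith
  have w1' := Real.log_le_log hw w1
  have w2' := Real.log_le_log (by positivity) w2
  have v1' := Real.log_le_log hv v1
  have v2' := Real.log_le_log (by positivity) v2
  rw [Real.log_mul (by positivity) hy.ne', Real.log_mul hd.ne' hfη.ne'] at w1'
  rw [Real.log_mul (by positivity) hx.ne', Real.log_mul hd.ne' hfη.ne'] at v1'
  rw [Real.log_mul (by positivity) hy.ne', Real.log_div hfη.ne' hd.ne'] at w2'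
  rw [Real.log_mul (by positivity) hx.ne', Real.log_div hfη.ne' hd.ne'] at v2'
  rw [abs_le]
  constructor <;> linarith

theorem sum_outMass_univ (hf : Continuous f) (Λ : Finset (Site d)) :
    ∑ ω, outMass ν f Λ ω = ∫ η, f η ∂ν := by
  have h := sum_outMass (ν := ν) hf Λ fun _ => True
  simpa using h

theorem sum_inMass_univ (hf : Continuous f) (Λ Δ : Finset (Site d)) (σ : Δ → Fin q) :
    ∑ ω, inMass ν f Λ Δ σ ω = ∫ ξ, transpose Δ σ f ξ ∂ν := by
  have h := sum_inMass (ν := ν) hf Λ Δ σ fun _ => True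
  simpa using h

/-- Up to an error from the oscillation of `f` on cylinders, the entropy loss due to a jump is a
constant minus a relative entropy in the box. -/
theorem jumpLoss_close {Λ Δ : Finset (Site d)} (hΔ : Δ ⊆ Λ) (σ : Δ → Fin q) {δ B : ℝ}
    (hδ : 0 ≤ δ) (hf : Continuous f) (h0 : 0 ≤ f) (hB : ∀ η, f η ≤ B) (hr : RatioClose f Λ δ) :
    jumpLoss ν f Λ Δ σ ≤
        (massDiff ν f Δ σ : EReal) - (boxEnt ν f Δ σ Λ : EReal) + ((2 * δ * B : ℝ) : EReal) ∧
      (massDiff ν f Δ σ : EReal) - (boxEnt ν f Δ σ Λ : EReal) ≤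
        jumpLoss ν f Λ Δ σ + ((2 * δ * B : ℝ) : EReal) := by
  by_cases h : ∀ᵐ η ∂ν, ν (cyl Λ (patch Δ σ η)) = 0 → f η = 0
  · have h1 := (ae_no_null_jump_iff hf h0 Λ Δ σ).1 h
    have hw0 (ω) := outMass_nonneg (ν := ν) h0 Λ ω
    have hv0 (ω) := inMass_nonneg (ν := ν) h0 Λ Δ σ ω
    have key (ω) (hw : outMass ν f Λ ω ≠ 0) := abs_log_mass_sub_le (ν := ν) (σ := σ) hΔ hδ hf h0 hr
      (lt_of_le_of_ne (hw0 ω) hw.symm)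
      (lt_of_le_of_ne measureReal_nonneg fun h2 => hw (h1 ω h2.symm))
    have hE : boxEnt ν f Δ σ Λ = ENNReal.ofReal (∑ ω, (outMass ν f Λ ω *
        (Real.log (outMass ν f Λ ω) - Real.log (inMass ν f Λ Δ σ ω)) - outMass ν f Λ ω +
          inMass ν f Λ Δ σ ω)) := by
      rw [ENNReal.ofReal_sum_of_nonneg fun ω _ =>
        relEnt_formula_nonneg (hv0 ω) (hw0 ω) fun hw => (key ω hw).1]
      exact Finset.sum_congr rfl fun ω _ => relEnt_eq (hv0 ω) (hw0 ω) fun hw => (key ω hw).1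
    rw [hE, EReal.coe_ennreal_ofReal, max_eq_left (Finset.sum_nonneg fun ω _ =>
      relEnt_formula_nonneg (hv0 ω) (hw0 ω) fun hw => (key ω hw).1), jumpLoss_eq_sum hf h,
      massDiff, ← sum_inMass_univ hf Λ Δ σ, ← sum_outMass_univ hf Λ]
    have hsum : ∑ ω, outMass ν f Λ ω ≤ B := by
      rw [sum_outMass_univ hf]
      refine (integral_mono (integrable_of_continuous hf ν) (integrable_const B) hB).trans ?_
      simp
    have hdiff : |∑ ω, outMass ν f Λ ω * (Real.log (ν.real (localCyl Λ (patchIn Λ Δ σ ω))) -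
        Real.log (ν.real (localCyl Λ ω))) - ((∑ ω, inMass ν f Λ Δ σ ω - ∑ ω, outMass ν f Λ ω) -
        ∑ ω, (outMass ν f Λ ω *
        (Real.log (outMass ν f Λ ω) - Real.log (inMass ν f Λ Δ σ ω)) - outMass ν f Λ ω +
          inMass ν f Λ Δ σ ω))| ≤ 2 * δ * B := by
      rw [← Finset.sum_sub_distrib, ← Finset.sum_sub_distrib, ← Finset.sum_sub_distrib]
      refine (Finset.abs_sum_le_sum_abs _ _).trans ?_
      refine le_trans (Finset.sum_le_sum (g := fun ω => 2 * δ * outMass ν f Λ ω)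
        fun ω _ => ?_) ?_
      · by_cases hw : outMass ν f Λ ω = 0
        · simp [hw]
        · have h2 := mul_le_mul_of_nonneg_left (key ω hw).2 (hw0 ω)
          rw [← abs_of_nonneg (hw0 ω), ← abs_mul, abs_of_nonneg (hw0 ω)] at h2
          refine le_trans (le_of_eq ?_) (h2.trans_eq (by ring))
          congr 1
          ring
      · rw [← Finset.mul_sum]
        exact mul_le_mul_of_nonneg_left hsum (by linarith)
    rw [abs_le] at hdiff
    simp only [← EReal.coe_sub, ← EReal.coe_add, EReal.coe_le_coe_iff]
    constructor <;> linarith [hdiff.1, hdiff.2]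
  · -- jumps lead with positive probability into a null cylinder: both sides are `-∞`
    have h1 := mt (ae_no_null_jump_iff hf h0 Λ Δ σ).2 h
    push Not at h1
    obtain ⟨ω, hx, hw⟩ := h1
    have hB0 : ∀ η ∈ localCyl Λ ω, f η ≤ B := fun η _ => hB η
    have hv : inMass ν f Λ Δ σ ω = 0 := by
      refine le_antisymm ?_ (inMass_nonneg h0 Λ Δ σ ω)
      have := inMass_le (ν := ν) (σ := σ) hΔ hf hB0
      rwa [hx, mul_zero] at this
    have hE : boxEnt ν f Δ σ Λ = ⊤ := by
      refine ENNReal.sum_eq_top.2 ⟨ω, Finset.mem_univ _, ?_⟩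
      rw [hv]
      exact relEnt_zero_left (lt_of_le_of_ne (outMass_nonneg h0 Λ ω) (Ne.symm hw))
    rw [hE, jumpLoss_eq_bot hf h0 h, EReal.coe_ennreal_top, EReal.sub_top]
    simp

/-! ### The limit of large boxes -/

/-- The limit of the entropy loss due to a jump as the box grows to the whole lattice. -/
noncomputable def jumpLossLim (ν : Measure (Config d q)) (f : Config d q → ℝ)
    (Δ : Finset (Site d)) (σ : Δ → Fin q) : EReal :=
  (massDiff ν f Δ σ : EReal) - ((⨆ Λ, boxEnt ν f Δ σ Λ : ℝ≥0∞) : EReal)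

theorem jumpLossLim_lt_top (ν : Measure (Config d q)) (f : Config d q → ℝ)
    (Δ : Finset (Site d)) (σ : Δ → Fin q) : jumpLossLim ν f Δ σ < ⊤ := by
  refine lt_of_le_of_lt (b := (massDiff ν f Δ σ : EReal)) ?_ (EReal.coe_lt_top _)
  exact EReal.sub_le_of_le_add (le_add_of_nonneg_right (EReal.coe_ennreal_nonneg _))

theorem tendsto_jumpLoss (hf : Continuous f) (h0 : 0 ≤ f)
    (hr : ∀ δ : ℝ, 0 < δ → ∀ᶠ Λ in atTop, RatioClose f Λ δ) (Δ : Finset (Site d))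
    (σ : Δ → Fin q) :
    Tendsto (fun Λ => jumpLoss ν f Λ Δ σ) atTop (𝓝 (jumpLossLim ν f Δ σ)) := by
  obtain ⟨B, hB⟩ : ∃ B, ∀ η, f η ≤ B := by
    obtain ⟨B, hB⟩ := isCompact_univ.exists_bound_of_continuousOn hf.continuousOn
    exact ⟨B, fun η => (le_abs_self _).trans (hB η (Set.mem_univ _))⟩
  have hB' : ∀ η, f η ≤ max B 1 := fun η => (hB η).trans (le_max_left _ _)
  have hpos : 0 < max B 1 := lt_max_of_lt_right one_pos
  refine tendsto_of_eventually_close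
    (g := fun Λ => (massDiff ν f Δ σ : EReal) - (boxEnt ν f Δ σ Λ : EReal)) ?_ fun δ hδ => ?_
  · have h1 : Tendsto (fun Λ => (boxEnt ν f Δ σ Λ : EReal)) atTop
        (𝓝 ((⨆ Λ, boxEnt ν f Δ σ Λ : ℝ≥0∞) : EReal)) :=
      (continuous_coe_ennreal_ereal.tendsto _).comp
        (tendsto_atTop_iSup (monotone_boxEnt hf Δ σ))
    refine (EReal.continuousAt_add (p := ((massDiff ν f Δ σ : EReal),
      -((⨆ Λ, boxEnt ν f Δ σ Λ : ℝ≥0∞) : EReal))) (Or.inl (EReal.coe_ne_top _))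
      (Or.inl (EReal.coe_ne_bot _))).tendsto.comp
      (tendsto_const_nhds.prodMk_nhds (continuous_neg.continuousAt.tendsto.comp h1))
  · filter_upwards [hr (δ / (2 * max B 1)) (by positivity), eventually_ge_atTop Δ] with Λ h1 h2
    have h3 := jumpLoss_close (ν := ν) h2 σ (by positivity) hf h0 hB' h1
    have h4 : 2 * (δ / (2 * max B 1)) * max B 1 = δ := by field_simp
    rwa [h4] at h3

end Jump

section Site

variable {d q : ℕ}

instance (ν : InvMeasure d q) : IsProbabilityMeasure ν.meas :=
  ν.1.2

/-! ### Translations -/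

theorem mem_translate {i x : Site d} {Λ : Finset (Site d)} : x ∈ translate i Λ ↔ x - i ∈ Λ := by
  simp only [translate, Finset.mem_map, addRightEmbedding_apply]
  exact ⟨fun ⟨y, hy, h⟩ => by rw [← h, add_sub_cancel_right]; exact hy,
    fun h => ⟨_, h, sub_add_cancel x i⟩⟩

theorem translate_translate_neg (i : Site d) (Λ : Finset (Site d)) :
    translate i (translate (-i) Λ) = Λ := by
  ext x
  simp [mem_translate]

theorem translate_neg_translate (i : Site d) (Λ : Finset (Site d)) :
    translate (-i) (translate i Λ) = Λ := by
  ext x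
  simp [mem_translate]

theorem card_translate (i : Site d) (Λ : Finset (Site d)) : (translate i Λ).card = Λ.card :=
  Finset.card_map _

/-- The shift as a measurable equivalence. -/
def shiftEquiv (d q : ℕ) (i : Site d) : Config d q ≃ᵐ Config d q where
  toFun := shift i
  invFun := shift (-i)
  left_inv η := by
    funext x
    simp [shift]
  right_inv η := by
    funext x
    simp [shift]
  measurable_toFun := measurable_pi_lambda _ fun x => measurable_pi_apply (x + i)
  measurable_invFun := measurable_pi_lambda _ fun x => measurable_pi_apply (x + -i)

theorem measure_cyl_translate (ν : InvMeasure d q) (i : Site d) (Λ : Finset (Site d))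
    (η : Config d q) : ν.meas (cyl (translate (-i) Λ) (shift i η)) = ν.meas (cyl Λ η) := by
  have h1 : cyl Λ η = shift i ⁻¹' cyl (translate (-i) Λ) (shift i η) := by
    ext ξ
    refine ⟨fun h x hx => ?_, fun h x hx => ?_⟩
    · rw [mem_translate, sub_neg_eq_add] at hx
      exact h _ hx
    · have := h (x - i) (by rw [mem_translate, sub_neg_eq_add, sub_add_cancel]; exact hx)
      simpa [shift] using this
  have h2 : ν.meas.map (shift i) = ν.meas := ν.2 i
  have h3 : MeasurableSet (cyl (translate (-i) Λ) (shift i η)) := by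
    rw [cyl_eq_localCyl]
    exact measurableSet_localCyl _ _
  rw [h1]
  exact (congrArg (fun μ : Measure (Config d q) => μ (cyl (translate (-i) Λ) (shift i η)))
    h2.symm).trans (Measure.map_apply (shiftEquiv d q i).measurable h3)

theorem shift_patch_translate (i : Site d) (Δ : Finset (Site d)) (σ : translate i Δ → Fin q)
    (η : Config d q) : shift i (patch (translate i Δ) σ η) =
      patch Δ (fun x => σ ⟨(x : Site d) + i, add_mem_translate i Δ x⟩) (shift i η) := by
  funext x
  by_cases h : x ∈ Δ
  · have h' : x + i ∈ translate i Δ := by rwa [mem_translate, add_sub_cancel_right]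
    simp [shift, patch, h, h']
  · have h' : x + i ∉ translate i Δ := by rwa [mem_translate, add_sub_cancel_right]
    simp [shift, patch, h, h']

/-! ### The entropy loss per site -/

/-- The rate `c_Δ(η, σ) / |Δ|`, shared equally among the sites of `Δ`. -/
noncomputable def siteRate (c : JumpRates d q) (Δ : Finset (Site d)) (σ : Δ → Fin q)
    (η : Config d q) : ℝ := c.rate Δ η σ * (Δ.card : ℝ)⁻¹

theorem continuous_siteRate (c : JumpRates d q) (Δ : Finset (Site d)) (σ : Δ → Fin q) :
    Continuous (siteRate c Δ σ) := (c.continuous_rate Δ σ).mul continuous_const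

theorem siteRate_nonneg (c : JumpRates d q) (Δ : Finset (Site d)) (σ : Δ → Fin q) :
    0 ≤ siteRate c Δ σ := fun η =>
  mul_nonneg (c.rate_nonneg Δ η σ) (inv_nonneg.2 (Nat.cast_nonneg _))

theorem jumpLoss_translate {c : JumpRates d q} (hti : c.TranslationInvariant)
    (ν : InvMeasure d q) (i : Site d) (Λ Δ : Finset (Site d)) (σ : translate i Δ → Fin q) :
    jumpLoss ν.meas (siteRate c (translate i Δ) σ) Λ (translate i Δ) σ =
      jumpLoss ν.meas (siteRate c Δ fun x => σ ⟨(x : Site d) + i, add_mem_translate i Δ x⟩)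
        (translate (-i) Λ) Δ fun x => σ ⟨(x : Site d) + i, add_mem_translate i Δ x⟩ := by
  have h2 : ν.meas.map (shiftEquiv d q i) = ν.meas := ν.2 i
  unfold jumpLoss
  conv_rhs =>
    congr
    rw [← h2]
  rw [extIntegral_map_equiv]
  refine congrArg _ (funext fun η => ?_)
  change _ = ((siteRate c Δ _ (shift i η) : ℝ) : EReal) *
    ENNReal.log (ν.meas (cyl (translate (-i) Λ) (patch Δ _ (shift i η))) /
      ν.meas (cyl (translate (-i) Λ) (shift i η)))
  rw [← shift_patch_translate, measure_cyl_translate, measure_cyl_translate]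
  simp only [siteRate, hti i Δ η σ, card_translate]

/-- The entropy loss in `Λ` attributed to the site `i`. -/
noncomputable def siteLoss (c : JumpRates d q) (ν : InvMeasure d q) (Λ : Finset (Site d))
    (i : Site d) : EReal :=
  ∑' Δ : {Δ : Finset (Site d) // i ∈ Δ}, ∑ σ : Δ.1 → Fin q,
    jumpLoss ν.meas (siteRate c Δ.1 σ) Λ Δ.1 σ

theorem extIntegral_logRatio (c : JumpRates d q) (ν : InvMeasure d q) (Λ Δ : Finset (Site d))
    (σ : Δ → Fin q) :
    (extIntegral ν.meas fun η => (c.rate Δ η σ : EReal) * (((Δ.card : ℝ)⁻¹ : ℝ) : EReal) *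
      logRatio ν Λ Δ σ η) = jumpLoss ν.meas (siteRate c Δ σ) Λ Δ σ := by
  refine extIntegral_congr_ae ?_
  filter_upwards [ae_measure_cyl_ne_zero ν.meas Λ] with η hη
  have hm : MeasurableSet (cyl (Λ \ Δ) η) := by
    rw [cyl_eq_localCyl]
    exact measurableSet_localCyl _ _
  have h1 (ζ : Config d q) (hζ : ∀ x, x ∉ Δ → ζ x = η x) :
      cyl (Λ \ Δ) η ∩ cyl (Δ ∩ Λ) ζ = cyl Λ ζ := by
    ext ξ
    refine ⟨fun h x hx => ?_, fun h => ⟨fun x hx => ?_, fun x hx => ?_⟩⟩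
    · by_cases hxΔ : x ∈ Δ
      · exact h.2 x (Finset.mem_inter.2 ⟨hxΔ, hx⟩)
      · rw [hζ x hxΔ]
        exact h.1 x (Finset.mem_sdiff.2 ⟨hx, hxΔ⟩)
    · rw [← hζ x (Finset.mem_sdiff.1 hx).2]
      exact h x (Finset.mem_sdiff.1 hx).1
    · exact h x (Finset.mem_inter.1 hx).2
  have h0 : ν.meas (cyl (Λ \ Δ) η) ≠ 0 := fun h0 =>
    hη (measure_mono_null (s := cyl Λ η) (t := cyl (Λ \ Δ) η)
      (fun ξ hξ x hx => hξ x (Finset.mem_sdiff.1 hx).1) h0)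
  rw [logRatio, cond_apply hm, cond_apply hm, h1 η fun _ _ => rfl,
    h1 (patch Δ σ η) fun x hx => by simp [patch, hx],
    ENNReal.mul_div_mul_left _ _ (ENNReal.inv_ne_zero.2 (measure_ne_top _ _))
      (ENNReal.inv_ne_top.2 h0), siteRate, EReal.coe_mul]

theorem approxEntropyLoss_eq (c : JumpRates d q) (ν : InvMeasure d q) (n : ℕ) :
    approxEntropyLoss c ν n = ((((cube d (2 ^ n - 1)).card : ℝ)⁻¹ : ℝ) : EReal) *
      ∑ i ∈ cube d (2 ^ n - n - 1), siteLoss c ν (cube d (2 ^ n - 1)) i := by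
  simp only [approxEntropyLoss, extIntegral_logRatio, siteLoss]

theorem rate_eq_zero_of_maxRate {c : JumpRates d q} {Δ : Finset (Site d)} (h : c.maxRate Δ = 0)
    (η : Config d q) (σ : Δ → Fin q) : c.rate Δ η σ = 0 := by
  have h1 : c.totalRate Δ η ≤ 0 :=
    ENNReal.ofReal_eq_zero.1 (ENNReal.iSup_eq_zero.1 h η)
  refine le_antisymm (le_trans ?_ h1) (c.rate_nonneg Δ η σ)
  exact Finset.single_le_sum (f := fun σ => c.rate Δ η σ) (fun σ _ => c.rate_nonneg Δ η σ)
    (Finset.mem_univ σ)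

theorem jumpLoss_eq_zero_of_rate (ν : Measure (Config d q)) {c : JumpRates d q}
    {Δ : Finset (Site d)} (h : ∀ η σ, c.rate Δ η σ = 0) (Λ : Finset (Site d)) (σ : Δ → Fin q) :
    jumpLoss ν (siteRate c Δ σ) Λ Δ σ = 0 := by
  simp [jumpLoss, siteRate, h, extIntegral]

theorem jumpLoss_eq_zero_of_disjoint (ν : Measure (Config d q)) [IsProbabilityMeasure ν]
    (f : Config d q → ℝ) {Λ Δ : Finset (Site d)} (h : Disjoint Δ Λ) (σ : Δ → Fin q) :
    jumpLoss ν f Λ Δ σ = 0 := by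
  have h1 (η : Config d q) : cyl Λ (patch Δ σ η) = cyl Λ η := by
    rw [cyl_eq_localCyl, cyl_eq_localCyl]
    congr 1
    funext x
    simp [restr, patch, Finset.disjoint_right.1 h x.2]
  unfold jumpLoss
  rw [extIntegral_congr_ae (g := fun _ => 0)]
  · simp [extIntegral]
  · filter_upwards [ae_measure_cyl_ne_zero ν Λ] with η hη
    rw [h1, ENNReal.div_self hη (measure_ne_top _ _), ENNReal.log_one, mul_zero]

/-- The entropy loss in `Λ` attributed to the origin, with jumps in subsets of `Γ` only. -/
noncomputable def originLoss (c : JumpRates d q) (Γ : Finset (Site d)) (ν : InvMeasure d q)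
    (Λ : Finset (Site d)) : EReal :=
  ∑ Δ ∈ Γ.powerset with 0 ∈ Δ, ∑ σ : Δ → Fin q, jumpLoss ν.meas (siteRate c Δ σ) Λ Δ σ

/-- Translation by `i` maps the sets that contain the origin onto those that contain `i`. -/
def translateEquiv (i : Site d) :
    {Δ : Finset (Site d) // 0 ∈ Δ} ≃ {Δ : Finset (Site d) // i ∈ Δ} where
  toFun Δ := ⟨translate i Δ.1, mem_translate.2 (by rw [sub_self]; exact Δ.2)⟩
  invFun Δ := ⟨translate (-i) Δ.1, mem_translate.2 (by rw [zero_sub, neg_neg]; exact Δ.2)⟩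
  left_inv Δ := Subtype.ext (translate_neg_translate i Δ.1)
  right_inv Δ := Subtype.ext (translate_translate_neg i Δ.1)

theorem siteLoss_eq_originLoss {c : JumpRates d q} (hti : c.TranslationInvariant)
    {Γ : Finset (Site d)} (hΓ : ∀ Δ : Finset (Site d), 0 ∈ Δ → ¬ Δ ⊆ Γ → c.maxRate Δ = 0)
    (ν : InvMeasure d q) (Λ : Finset (Site d)) (i : Site d) :
    siteLoss c ν Λ i = originLoss c Γ ν (translate (-i) Λ) := by
  have h1 (Δ : Finset (Site d)) :
      ∑ σ : translate i Δ → Fin q, jumpLoss ν.meas (siteRate c (translate i Δ) σ) Λ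
        (translate i Δ) σ =
      ∑ σ : Δ → Fin q, jumpLoss ν.meas (siteRate c Δ σ) (translate (-i) Λ) Δ σ := by
    let e : Δ ≃ translate i Δ :=
      { toFun := fun x => ⟨(x : Site d) + i, add_mem_translate i Δ x⟩
        invFun := fun x => ⟨(x : Site d) - i, mem_translate.1 x.2⟩
        left_inv := fun x => Subtype.ext (add_sub_cancel_right _ _)
        right_inv := fun x => Subtype.ext (sub_add_cancel _ _) }
    refine Fintype.sum_equiv (e.symm.arrowCongr (Equiv.refl _)) _ _ fun σ => ?_
    exact jumpLoss_translate hti ν i Λ Δ σ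
  rw [siteLoss, ← (translateEquiv i).tsum_eq]
  change ∑' Δ : {Δ : Finset (Site d) // 0 ∈ Δ}, ∑ σ : translate i Δ.1 → Fin q,
    jumpLoss ν.meas (siteRate c (translate i Δ.1) σ) Λ (translate i Δ.1) σ = _
  simp only [h1]
  rw [originLoss, tsum_eq_sum (s := Γ.powerset.subtype fun Δ => 0 ∈ Δ)]
  · exact (Finset.sum_subtype_eq_sum_filter (s := Γ.powerset) (p := fun Δ => 0 ∈ Δ)
      fun Δ => ∑ σ : Δ → Fin q, jumpLoss ν.meas (siteRate c Δ σ) (translate (-i) Λ) Δ σ)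
  · intro Δ hΔ
    rw [Finset.mem_subtype, Finset.mem_powerset] at hΔ
    exact Finset.sum_eq_zero fun σ _ =>
      jumpLoss_eq_zero_of_rate _ (rate_eq_zero_of_maxRate (hΓ Δ.1 Δ.2 hΔ)) _ _

theorem eventually_ratioClose {c : JumpRates d q} (huc : c.UniformlyContinuousRates)
    (hmin : c.HasMinimalRate) {Δ : Finset (Site d)} (hΔ : 0 ∈ Δ) (σ : Δ → Fin q) {δ : ℝ}
    (hδ : 0 < δ) : ∀ᶠ Λ in atTop, RatioClose (siteRate c Δ σ) Λ δ := by
  rcases eq_or_ne (c.maxRate Δ) 0 with h | h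
  · refine Eventually.of_forall fun Λ η ξ _ => ?_
    simp [siteRate, rate_eq_zero_of_maxRate h]
  · obtain ⟨m, hm, hrate⟩ := hmin Δ (pos_iff_ne_zero.2 h)
    -- an oscillation below `m` cannot leave the set where the rate vanishes
    filter_upwards [huc (min (m / 2) (δ * m)) (lt_min (by positivity) (by positivity))]
      with Λ hΛ η ξ hηξ
    have h1 : patch Λ (fun x => η x) ξ = ξ := by
      funext x
      by_cases hx : x ∈ Λ
      · simpa [patch, hx, restr] using congrFun hηξ ⟨x, hx⟩
      · simp [patch, hx]
    have h2 := hΛ Δ hΔ η ξ σ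
    rw [h1] at h2
    have h3 := (le_abs_self _).trans (h2.trans (min_le_left _ _))
    have h4 := (le_abs_self _).trans (h2.trans (min_le_right _ _))
    have h5 : c.rate Δ ξ σ ≤ (1 + δ) * c.rate Δ η σ := by
      rcases (c.rate_nonneg Δ η σ).eq_or_lt with h0 | h0
      · rcases (c.rate_nonneg Δ ξ σ).eq_or_lt with h0' | h0'
        · rw [← h0, ← h0', mul_zero]
        · have := hrate ξ σ h0'
          linarith
      · have := mul_le_mul_of_nonneg_left (hrate η σ h0) hδ.le
        linarith
    rw [siteRate, siteRate, ← mul_assoc]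
    exact mul_le_mul_of_nonneg_right h5 (inv_nonneg.2 (Nat.cast_nonneg _))

/-- The approximated specific entropy loss, as a sum of limits over the jumps at the origin. -/
noncomputable def lossDensity (c : JumpRates d q) (Γ : Finset (Site d)) (ν : InvMeasure d q) :
    EReal :=
  ∑ Δ ∈ Γ.powerset with 0 ∈ Δ, ∑ σ : Δ → Fin q, jumpLossLim ν.meas (siteRate c Δ σ) Δ σ

theorem tendsto_originLoss {c : JumpRates d q} (huc : c.UniformlyContinuousRates)
    (hmin : c.HasMinimalRate) (Γ : Finset (Site d)) (ν : InvMeasure d q) :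
    lossDensity c Γ ν < ⊤ ∧ Tendsto (originLoss c Γ ν) atTop (𝓝 (lossDensity c Γ ν)) := by
  have h (Δ) (hΔ : Δ ∈ Γ.powerset.filter (0 ∈ ·)) := tendsto_sum_of_lt_top (l := atTop)
    (Finset.univ : Finset (Δ → Fin q))
    (u := fun σ Λ => jumpLoss ν.meas (siteRate c Δ σ) Λ Δ σ)
    (fun σ _ => jumpLossLim_lt_top ν.meas (siteRate c Δ σ) Δ σ)
    fun σ _ => tendsto_jumpLoss (continuous_siteRate c Δ σ) (siteRate_nonneg c Δ σ)
      (fun δ hδ => eventually_ratioClose huc hmin (Finset.mem_filter.1 hΔ).2 σ hδ) Δ σ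
  exact tendsto_sum_of_lt_top _ (fun Δ hΔ => (h Δ hΔ).1) fun Δ hΔ => (h Δ hΔ).2

theorem exists_originLoss_le (c : JumpRates d q) (Γ : Finset (Site d)) (ν : InvMeasure d q) :
    ∃ C : ℝ, ∀ Λ, originLoss c Γ ν Λ ≤ (C : EReal) := by
  have h (Δ : Finset (Site d)) (σ : Δ → Fin q) :
      ∃ C : ℝ, ∀ Λ, jumpLoss ν.meas (siteRate c Δ σ) Λ Δ σ ≤ (C : EReal) := by
    obtain ⟨B, hB⟩ := isCompact_univ.exists_bound_of_continuousOn
      (continuous_siteRate c Δ σ).continuousOn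
    exact ⟨_, fun Λ => jumpLoss_le (continuous_siteRate c Δ σ) (siteRate_nonneg c Δ σ)
      (fun η => (le_abs_self _).trans (hB η (Set.mem_univ _))) Λ Δ σ⟩
  choose C hC using h
  refine ⟨∑ Δ ∈ Γ.powerset with 0 ∈ Δ, ∑ σ : Δ → Fin q, C Δ σ, fun Λ => ?_⟩
  simp only [coe_sum]
  exact Finset.sum_le_sum fun Δ _ => Finset.sum_le_sum fun σ _ => hC Δ σ Λ

/-! ### Upper semicontinuity -/

theorem continuous_integral_meas {f : Config d q → ℝ} (hf : Continuous f) :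
    Continuous fun ν : InvMeasure d q => ∫ η, f η ∂ν.meas := by
  refine Continuous.comp (g := fun μ : ProbabilityMeasure (Config d q) =>
    ∫ η, f η ∂(μ : Measure (Config d q))) ?_ continuous_subtype_val
  refine continuous_iff_continuousAt.2 fun μ => ?_
  exact (ProbabilityMeasure.tendsto_iff_forall_integral_tendsto.1 tendsto_id)
    (BoundedContinuousFunction.mkOfCompact ⟨f, hf⟩)

theorem upperSemicontinuous_lossDensity (c : JumpRates d q) (Γ : Finset (Site d)) :
    UpperSemicontinuous (lossDensity c Γ) := by
  have h1 : lossDensity c Γ = fun ν : InvMeasure d q =>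
      ((∑ Δ ∈ Γ.powerset with 0 ∈ Δ, ∑ σ : Δ → Fin q,
        massDiff ν.meas (siteRate c Δ σ) Δ σ : ℝ) : EReal) +
      -((∑ Δ ∈ Γ.powerset with 0 ∈ Δ, ∑ σ : Δ → Fin q,
        ⨆ Λ, boxEnt ν.meas (siteRate c Δ σ) Δ σ Λ : ℝ≥0∞) : EReal) := by
    funext ν
    simp only [lossDensity, jumpLossLim, sum_coe_sub_coe, ← sub_eq_add_neg]
  rw [h1]
  refine UpperSemicontinuous.add' ?_ ?_ fun ν => EReal.continuousAt_add
    (Or.inl (EReal.coe_ne_top _)) (Or.inl (EReal.coe_ne_bot _))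
  · refine Continuous.upperSemicontinuous (continuous_coe_real_ereal.comp ?_)
    refine continuous_finsetSum _ fun Δ _ => continuous_finsetSum _ fun σ _ => ?_
    exact (continuous_integral_meas (continuous_transpose Δ σ (continuous_siteRate c Δ σ))).sub
      (continuous_integral_meas (continuous_siteRate c Δ σ))
  · refine (continuous_neg.comp continuous_coe_ennreal_ereal).comp_lowerSemicontinuous_antitone
      (f := fun ν : InvMeasure d q => ∑ Δ ∈ Γ.powerset with 0 ∈ Δ, ∑ σ : Δ → Fin q,
        ⨆ Λ, boxEnt ν.meas (siteRate c Δ σ) Δ σ Λ) ?_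
      fun a b hab => EReal.neg_le_neg_iff.2 (EReal.coe_ennreal_le_coe_ennreal_iff.2 hab)
    refine lowerSemicontinuous_sum fun Δ _ => lowerSemicontinuous_sum fun σ _ =>
      lowerSemicontinuous_iSup fun Λ => lowerSemicontinuous_sum fun ω _ =>
        lowerSemicontinuous_relEnt ?_ ?_
    · exact continuous_integral_meas (continuous_transpose Δ σ
        (continuous_localCyl_indicator Λ ω (continuous_siteRate c Δ σ)))
    · exact continuous_integral_meas
        (continuous_localCyl_indicator Λ ω (continuous_siteRate c Δ σ))

end Site

section Entropy

variable {d q : ℕ}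

/-! ### The entropy loss in a box is at most the sum of the losses per site -/

/-- The rate of change of the probability of a cylinder due to the jumps to `σ` in `Δ`. -/
noncomputable def cylFlow (c : JumpRates d q) (ν : Measure (Config d q)) (Λ : Finset (Site d))
    (ω : Λ → Fin q) (Δ : Finset (Site d)) (σ : Δ → Fin q) : ℝ :=
  ∫ η, c.rate Δ η σ * ((localCyl Λ ω).indicator (fun _ => 1) (patch Δ σ η) -
    (localCyl Λ ω).indicator (fun _ => 1) η) ∂ν

theorem integrable_cylFlow (c : JumpRates d q) (ν : Measure (Config d q)) [IsFiniteMeasure ν]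
    (Λ : Finset (Site d)) (ω : Λ → Fin q) (Δ : Finset (Site d)) (σ : Δ → Fin q) :
    Integrable (fun η => c.rate Δ η σ * ((localCyl Λ ω).indicator (fun _ => (1 : ℝ))
      (patch Δ σ η) - (localCyl Λ ω).indicator (fun _ => 1) η)) ν := by
  have h := continuous_localCyl_indicator Λ ω (continuous_const (y := (1 : ℝ)))
  exact integrable_of_continuous ((c.continuous_rate Δ σ).mul
    ((h.comp (continuous_patch Δ σ)).sub h)) ν

theorem integral_generator {c : JumpRates d q} {Λ E : Finset (Site d)}
    (hE : ∀ Δ : Finset (Site d), ¬ Disjoint Δ Λ → ¬ Δ ⊆ E → ∀ η σ, c.rate Δ η σ = 0)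
    (ν : Measure (Config d q)) [IsFiniteMeasure ν] (ω : Λ → Fin q) :
    ∫ η, c.generator ((localCyl Λ ω).indicator fun _ => 1) η ∂ν =
      ∑ Δ ∈ E.powerset with ¬ Disjoint Δ Λ, ∑ σ : Δ → Fin q, cylFlow c ν Λ ω Δ σ := by
  unfold cylFlow
  simp only [← integral_finsetSum _ fun σ _ => integrable_cylFlow c ν Λ ω _ σ]
  rw [← integral_finsetSum _ fun Δ _ => integrable_finsetSum _ fun σ _ =>
    integrable_cylFlow c ν Λ ω Δ σ]
  refine integral_congr_ae (ae_of_all _ fun η => tsum_eq_sum fun Δ hΔ => ?_)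
  rw [Finset.mem_filter, Finset.mem_powerset, not_and_or, not_not] at hΔ
  refine Finset.sum_eq_zero fun σ _ => ?_
  by_cases h : Disjoint Δ Λ
  · have h1 : patch Δ σ η ∈ localCyl Λ ω ↔ η ∈ localCyl Λ ω := by
      refine forall_congr' fun x => ?_
      simp [patch, Finset.disjoint_right.1 h x.2]
    by_cases h2 : η ∈ localCyl Λ ω <;> simp [h1, h2]
  · rw [hE Δ h (hΔ.resolve_right h), zero_mul]

/-- No mass flows out of a null cylinder. -/
theorem cylFlow_of_null {c : JumpRates d q} {ν : Measure (Config d q)}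
    {Λ : Finset (Site d)} {ω : Λ → Fin q} (h : ν (localCyl Λ ω) = 0) (Δ : Finset (Site d))
    (σ : Δ → Fin q) : cylFlow c ν Λ ω Δ σ =
      ∫ η, c.rate Δ η σ * (localCyl Λ ω).indicator (fun _ => 1) (patch Δ σ η) ∂ν := by
  refine integral_congr_ae ?_
  filter_upwards [measure_eq_zero_iff_ae_notMem.1 h] with η hη
  rw [Set.indicator_of_notMem hη, sub_zero]

theorem cylFlow_nonneg_of_null {c : JumpRates d q} {ν : Measure (Config d q)}
    {Λ : Finset (Site d)} {ω : Λ → Fin q} (h : ν (localCyl Λ ω) = 0) (Δ : Finset (Site d))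
    (σ : Δ → Fin q) : 0 ≤ cylFlow c ν Λ ω Δ σ := by
  rw [cylFlow_of_null h]
  exact integral_nonneg fun η => mul_nonneg (c.rate_nonneg Δ η σ)
    (Set.indicator_nonneg (fun _ _ => zero_le_one) _)

/-- If no null cylinder gains mass, then almost surely no jump leads into a null cylinder. -/
theorem ae_rate_eq_zero {c : JumpRates d q} {ν : Measure (Config d q)} [IsFiniteMeasure ν]
    {Λ Δ : Finset (Site d)} {σ : Δ → Fin q}
    (h : ∀ ω, ν (localCyl Λ ω) = 0 → cylFlow c ν Λ ω Δ σ = 0) :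
    ∀ᵐ η ∂ν, ν (cyl Λ (patch Δ σ η)) = 0 → c.rate Δ η σ = 0 := by
  have h1 : ∀ᵐ η ∂ν, ∀ ω, ν (localCyl Λ ω) = 0 →
      c.rate Δ η σ * (localCyl Λ ω).indicator (fun _ => (1 : ℝ)) (patch Δ σ η) = 0 := by
    refine ae_all_iff.2 fun ω => ?_
    by_cases h0 : ν (localCyl Λ ω) = 0
    · have h2 := h ω h0
      rw [cylFlow_of_null h0, integral_eq_zero_iff_of_nonneg (fun η => mul_nonneg
        (c.rate_nonneg Δ η σ) (Set.indicator_nonneg (fun _ _ => zero_le_one) _))] at h2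
      · filter_upwards [h2] with η hη _ using hη
      · exact integrable_of_continuous ((c.continuous_rate Δ σ).mul
          ((continuous_localCyl_indicator Λ ω continuous_const).comp (continuous_patch Δ σ))) ν
    · exact ae_of_all _ fun η hc => absurd hc h0
  filter_upwards [h1] with η hη h0
  rw [cyl_eq_localCyl] at h0
  have h2 := hη _ h0
  rwa [Set.indicator_of_mem (mem_localCyl.2 rfl), mul_one] at h2

/-- The expected change of `g(η_Λ)` due to a jump, computed from the flows of the cylinders. -/
theorem sum_cylFlow_mul (c : JumpRates d q) (ν : Measure (Config d q)) [IsFiniteMeasure ν]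
    (Λ Δ : Finset (Site d)) (σ : Δ → Fin q) (g : (Λ → Fin q) → ℝ) :
    ∑ ω, cylFlow c ν Λ ω Δ σ * g ω =
      ∫ η, c.rate Δ η σ * (g (restr Λ (patch Δ σ η)) - g (restr Λ η)) ∂ν := by
  unfold cylFlow
  simp only [← integral_mul_const]
  rw [← integral_finsetSum _ fun ω _ => (integrable_cylFlow c ν Λ ω Δ σ).mul_const _]
  refine integral_congr_ae (ae_of_all _ fun η => ?_)
  have h (ξ : Config d q) :
      ∑ ω, (localCyl Λ ω).indicator (fun _ => (1 : ℝ)) ξ * g ω = g (restr Λ ξ) := by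
    rw [Finset.sum_eq_single (restr Λ ξ), Set.indicator_of_mem (mem_localCyl.2 rfl), one_mul]
    · intro ω _ h
      rw [Set.indicator_of_notMem fun h' => h (mem_localCyl.1 h').symm, zero_mul]
    · simp
  simp only [mul_assoc, sub_mul, ← Finset.mul_sum, Finset.sum_sub_distrib, h]

/-- The entropy loss in `Λ` is `-∞` if some null cylinder gains mass. Otherwise it is the sum of
the losses due to all jumps that meet `Λ`, and the loss of each jump in `Δ` is shared among the
sites of `Δ`. -/
theorem entropyLossIn_le {c : JumpRates d q} {Λ E : Finset (Site d)} (hΛ : Λ.Nonempty)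
    (hE : ∀ Δ : Finset (Site d), ¬ Disjoint Δ Λ → ¬ Δ ⊆ E → ∀ η σ, c.rate Δ η σ = 0)
    (ν : InvMeasure d q) : entropyLossIn c ν Λ ≤
      (((Λ.card : ℝ)⁻¹ : ℝ) : EReal) * ∑ i ∈ E, siteLoss c ν Λ i := by
  have hpos : 0 < (Λ.card : ℝ)⁻¹ := inv_pos.2 (Nat.cast_pos.2 hΛ.card_pos)
  unfold entropyLossIn
  simp only [integral_generator hE]
  by_cases hnull : ∀ ω, ν.meas (localCyl Λ ω) = 0 → ∀ Δ ∈ E.powerset.filter (¬ Disjoint · Λ),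
      ∀ σ : Δ → Fin q, cylFlow c ν.meas Λ ω Δ σ = 0
  swap
  · -- null cylinders only gain mass, so that a nonzero flow into one gives a term `-∞`
    push Not at hnull
    obtain ⟨ω, h0, Δ, hΔ, σ, hσ⟩ := hnull
    refine le_trans (le_of_eq ?_) bot_le
    rw [sum_eq_bot (Finset.mem_univ ω), EReal.coe_mul_bot_of_pos hpos]
    rw [h0, ENNReal.log_zero]
    refine EReal.coe_mul_bot_of_pos ?_
    refine Finset.sum_pos' (fun Δ _ => Finset.sum_nonneg fun σ _ => cylFlow_nonneg_of_null h0 Δ σ)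
      ⟨Δ, hΔ, Finset.sum_pos' (fun σ _ => cylFlow_nonneg_of_null h0 Δ σ)
        ⟨σ, Finset.mem_univ _, lt_of_le_of_ne (cylFlow_nonneg_of_null h0 Δ σ) hσ.symm⟩⟩
  refine mul_le_mul_of_nonneg_left (le_of_eq ?_) (EReal.coe_nonneg.2 hpos.le)
  let b (Δ : Finset (Site d)) (σ : Δ → Fin q) : ℝ := ∫ η, c.rate Δ η σ *
    (Real.log (ν.meas.real (cyl Λ (patch Δ σ η))) - Real.log (ν.meas.real (cyl Λ η))) ∂ν.meas
  have hloss (Δ) (hΔ : Δ ∈ E.powerset.filter (¬ Disjoint · Λ)) (σ : Δ → Fin q) :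
      jumpLoss ν.meas (siteRate c Δ σ) Λ Δ σ = (((Δ.card : ℝ)⁻¹ * b Δ σ : ℝ) : EReal) := by
    have h1 := ae_rate_eq_zero (c := c) (ν := ν.meas) (Λ := Λ) (σ := σ)
      fun ω h0 => hnull ω h0 Δ hΔ σ
    rw [jumpLoss_eq_integral (continuous_siteRate c Δ σ), ← integral_const_mul]
    · congr 2
      funext η
      rw [siteRate]
      ring
    · filter_upwards [h1] with η hη h0
      rw [siteRate, hη h0, zero_mul]
  have hsite (i : Site d) : siteLoss c ν Λ i =
      ((∑ Δ ∈ (E.powerset.filter (¬ Disjoint · Λ)).filter (i ∈ ·),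
        (Δ.card : ℝ)⁻¹ * ∑ σ, b Δ σ : ℝ) : EReal) := by
    rw [siteLoss, tsum_eq_sum (s := (E.powerset.filter (¬ Disjoint · Λ)).subtype (i ∈ ·)),
      Finset.sum_subtype_eq_sum_filter (p := (i ∈ ·)) (f := fun Δ : Finset (Site d) =>
        ∑ σ : Δ → Fin q, jumpLoss ν.meas (siteRate c Δ σ) Λ Δ σ), coe_sum]
    · refine Finset.sum_congr rfl fun Δ hΔ => ?_
      rw [Finset.mul_sum, coe_sum]
      exact Finset.sum_congr rfl fun σ _ => hloss Δ (Finset.mem_filter.1 hΔ).1 σ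
    · intro Δ hΔ
      rw [Finset.mem_subtype, Finset.mem_filter, Finset.mem_powerset, not_and_or, not_not] at hΔ
      refine Finset.sum_eq_zero fun σ _ => ?_
      by_cases h : Disjoint Δ.1 Λ
      · exact jumpLoss_eq_zero_of_disjoint _ _ h σ
      · exact jumpLoss_eq_zero_of_rate _ (hE _ h (hΔ.resolve_right h)) Λ σ
  have hshare : ∑ i ∈ E, ∑ Δ ∈ (E.powerset.filter (¬ Disjoint · Λ)).filter (i ∈ ·),
      (Δ.card : ℝ)⁻¹ * ∑ σ, b Δ σ =
      ∑ Δ ∈ E.powerset.filter (¬ Disjoint · Λ), ∑ σ, b Δ σ := by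
    rw [Finset.sum_comm' (t' := E.powerset.filter (¬ Disjoint · Λ)) (s' := fun Δ => Δ)]
    · refine Finset.sum_congr rfl fun Δ hΔ => ?_
      have h1 : Δ.Nonempty := by
        rw [Finset.nonempty_iff_ne_empty]
        rintro rfl
        exact (Finset.mem_filter.1 hΔ).2 (Finset.disjoint_empty_left _)
      rw [Finset.sum_const, nsmul_eq_mul, ← mul_assoc,
        mul_inv_cancel₀ (Nat.cast_ne_zero.2 h1.card_pos.ne'), one_mul]
    · intro i Δ
      simp only [Finset.mem_filter, Finset.mem_powerset]
      exact ⟨fun h => ⟨h.2.2, h.2.1⟩, fun h => ⟨h.2.1 h.1, h.2, h.1⟩⟩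
  simp only [hsite, ← coe_sum, hshare]
  have hterm (ω : Λ → Fin q) :
      ((∑ Δ ∈ E.powerset.filter (¬ Disjoint · Λ), ∑ σ : Δ → Fin q,
        cylFlow c ν.meas Λ ω Δ σ : ℝ) : EReal) * ENNReal.log (ν.meas (localCyl Λ ω)) =
      (((∑ Δ ∈ E.powerset.filter (¬ Disjoint · Λ), ∑ σ : Δ → Fin q,
        cylFlow c ν.meas Λ ω Δ σ) * Real.log (ν.meas.real (localCyl Λ ω)) : ℝ) : EReal) := by
    by_cases h0 : ν.meas (localCyl Λ ω) = 0
    · rw [Finset.sum_eq_zero fun Δ hΔ => Finset.sum_eq_zero fun σ _ => hnull ω h0 Δ hΔ σ]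
      simp
    · rw [ENNReal.log_pos_real h0 (measure_ne_top _ _), EReal.coe_mul]
      rfl
  simp only [hterm, ← coe_sum]
  congr 1
  simp only [Finset.sum_mul]
  rw [Finset.sum_comm]
  refine Finset.sum_congr rfl fun Δ _ => ?_
  rw [Finset.sum_comm]
  refine Finset.sum_congr rfl fun σ _ => ?_
  rw [sum_cylFlow_mul c ν.meas Λ Δ σ fun ω => Real.log (ν.meas.real (localCyl Λ ω))]
  simp only [b, cyl_eq_localCyl]

end Entropy

section Cubes

variable {d q : ℕ}

/-! ### Averages over cubes -/

theorem mem_cube {r : ℤ} {x : Site d} : x ∈ cube d r ↔ ∀ k, -r ≤ x k ∧ x k ≤ r := by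
  rw [cube, Finset.mem_Icc, Pi.le_def, Pi.le_def, forall_and]

theorem cube_mono {r s : ℤ} (h : r ≤ s) : cube d r ⊆ cube d s := fun _ hx =>
  mem_cube.2 fun k => ⟨by linarith [(mem_cube.1 hx k).1], (mem_cube.1 hx k).2.trans h⟩

theorem cube_nonempty {r : ℤ} (h : 0 ≤ r) : (cube d r).Nonempty :=
  ⟨0, mem_cube.2 fun _ => ⟨by simpa using h, h⟩⟩

theorem exists_subset_cube (S : Finset (Site d)) : ∃ l : ℕ, S ⊆ cube d l := by
  refine ⟨∑ x ∈ S, ∑ k, (x k).natAbs, fun x hx => mem_cube.2 fun k => abs_le.1 ?_⟩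
  rw [Int.abs_eq_natAbs]
  exact_mod_cast (Finset.single_le_sum (f := fun k => (x k).natAbs) (fun _ _ => Nat.zero_le _)
    (Finset.mem_univ k)).trans (Finset.single_le_sum (f := fun x : Site d => ∑ k, (x k).natAbs)
      (fun _ _ => Nat.zero_le _) hx)

theorem subset_translate_cube {r s l : ℤ} (h : s + l ≤ r) {i : Site d} (hi : i ∈ cube d s) :
    cube d l ⊆ translate (-i) (cube d r) := fun x hx => by
  rw [mem_translate, sub_neg_eq_add, mem_cube]
  intro k
  have h1 := mem_cube.1 hi k
  have h2 := mem_cube.1 hx k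
  rw [Pi.add_apply]
  constructor <;> linarith [h1.1, h1.2, h2.1, h2.2]

theorem card_cube {r : ℤ} (h : 0 ≤ r) : ((cube d r).card : ℝ) = (2 * (r : ℝ) + 1) ^ d := by
  have h1 : (cube d r).card = (2 * r + 1).toNat ^ d := by
    rw [cube, Pi.card_Icc]
    simp only [Int.card_Icc, Finset.prod_const, Finset.card_univ, Fintype.card_fin]
    congr 2
    ring
  have h2 : (((2 * r + 1).toNat : ℤ) : ℝ) = 2 * (r : ℝ) + 1 := by
    rw [Int.toNat_of_nonneg (by linarith)]
    push_cast
    ring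
  rw [h1, Nat.cast_pow, ← h2, Int.cast_natCast]

theorem tendsto_card_cube_ratio {r s : ℕ → ℤ} (hr : ∀ᶠ n in atTop, 0 ≤ r n)
    (hs : ∀ᶠ n in atTop, 0 ≤ s n)
    (h : Tendsto (fun n => ((s n - r n : ℤ) : ℝ) / (2 * (r n : ℝ) + 1)) atTop (𝓝 0)) :
    Tendsto (fun n => ((cube d (r n)).card : ℝ)⁻¹ * (cube d (s n)).card) atTop (𝓝 1) := by
  have h1 : Tendsto (fun n => (1 + 2 * (((s n - r n : ℤ) : ℝ) / (2 * (r n : ℝ) + 1))) ^ d) atTop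
      (𝓝 ((1 + 2 * 0) ^ d)) := ((h.const_mul 2).const_add 1).pow d
  rw [mul_zero, add_zero, one_pow] at h1
  refine h1.congr' ?_
  filter_upwards [hr, hs] with n hrn hsn
  have h2 : (0 : ℝ) < 2 * (r n : ℝ) + 1 := by
    have : (0 : ℝ) ≤ r n := by exact_mod_cast hrn
    linarith
  rw [card_cube hrn, card_cube hsn, ← inv_pow, ← mul_pow]
  congr 1
  field_simp
  push_cast
  ring

theorem tendsto_const_div_add (a b : ℝ) :
    Tendsto (fun n : ℕ => a / (2 * (n : ℝ) + b)) atTop (𝓝 0) :=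
  tendsto_const_nhds.div_atTop
    (tendsto_atTop_add_const_right _ _ (tendsto_natCast_atTop_atTop.const_mul_atTop two_pos))

theorem sum_le_card_mul {ι : Type*} {s : Finset ι} {u : ι → EReal} {a : ℝ}
    (h : ∀ i ∈ s, u i ≤ (a : EReal)) : ∑ i ∈ s, u i ≤ ((s.card * a : ℝ) : EReal) := by
  rw [← nsmul_eq_mul, ← Finset.sum_const, coe_sum]
  exact Finset.sum_le_sum h

theorem card_mul_le_sum {ι : Type*} {s : Finset ι} {u : ι → EReal} {a : ℝ}
    (h : ∀ i ∈ s, (a : EReal) ≤ u i) : ((s.card * a : ℝ) : EReal) ≤ ∑ i ∈ s, u i := by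
  rw [← nsmul_eq_mul, ← Finset.sum_const, coe_sum]
  exact Finset.sum_le_sum h

/-- Averages of a quantity that converges as the box grows, over translates of cubes by vectors
that stay away from the boundary. -/
theorem tendsto_average {A : Finset (Site d) → EReal} {G : EReal}
    (hA : Tendsto A atTop (𝓝 G)) {r s : ℕ → ℤ} (hr : ∀ᶠ n in atTop, 0 ≤ r n)
    (hs : ∀ᶠ n in atTop, 0 ≤ s n) (hrs : Tendsto (fun n => r n - s n) atTop atTop)
    (h : Tendsto (fun n => ((s n - r n : ℤ) : ℝ) / (2 * (r n : ℝ) + 1)) atTop (𝓝 0)) :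
    Tendsto (fun n => ((((cube d (r n)).card : ℝ)⁻¹ : ℝ) : EReal) *
      ∑ i ∈ cube d (s n), A (translate (-i) (cube d (r n)))) atTop (𝓝 G) := by
  have hratio := tendsto_card_cube_ratio (d := d) hr hs h
  have hev {P : Finset (Site d) → Prop} (hP : ∀ᶠ Λ in atTop, P Λ) :
      ∀ᶠ n in atTop, ∀ i ∈ cube d (s n), P (translate (-i) (cube d (r n))) := by
    obtain ⟨S, hS⟩ := eventually_atTop.1 hP
    obtain ⟨l, hl⟩ := exists_subset_cube S
    filter_upwards [hrs.eventually_ge_atTop (l : ℤ)] with n hn i hi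
    exact hS _ (hl.trans (subset_translate_cube (by linarith) hi))
  have hnn (n : ℕ) : (0 : EReal) ≤ ((((cube d (r n)).card : ℝ)⁻¹ : ℝ) : EReal) :=
    EReal.coe_nonneg.2 (inv_nonneg.2 (Nat.cast_nonneg _))
  have hlim (a : ℝ) : Tendsto (fun n => ((((cube d (r n)).card : ℝ)⁻¹ : ℝ) : EReal) *
      (((cube d (s n)).card * a : ℝ) : EReal)) atTop (𝓝 (a : EReal)) := by
    have h1 := (continuous_coe_real_ereal.tendsto _).comp (hratio.mul_const a)
    rw [one_mul] at h1
    refine h1.congr fun n => ?_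
    rw [Function.comp_apply, mul_assoc, EReal.coe_mul]
  refine tendsto_order.2 ⟨fun a ha => ?_, fun a ha => ?_⟩
  · obtain ⟨b, hab, hb⟩ := EReal.lt_iff_exists_real_btwn.1 ha
    filter_upwards [hev (hA.eventually (lt_mem_nhds hb)),
      (hlim b).eventually (lt_mem_nhds hab)] with n h1 h2
    exact h2.trans_le (mul_le_mul_of_nonneg_left (card_mul_le_sum fun i hi => (h1 i hi).le) (hnn n))
  · obtain ⟨b, hb, hab⟩ := EReal.lt_iff_exists_real_btwn.1 ha
    filter_upwards [hev (hA.eventually (gt_mem_nhds hb)),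
      (hlim b).eventually (gt_mem_nhds hab)] with n h1 h2
    exact lt_of_le_of_lt
      (mul_le_mul_of_nonneg_left (sum_le_card_mul fun i hi => (h1 i hi).le) (hnn n)) h2

/-- The same average over a slightly larger cube, where only an upper bound is available near the
boundary. -/
theorem limsup_average_le {A : Finset (Site d) → EReal} {G : EReal}
    (hA : Tendsto A atTop (𝓝 G)) {C : ℝ} (hC : ∀ Λ, A Λ ≤ (C : EReal)) (r : ℕ) :
    limsup (fun n : ℕ => ((((cube d n).card : ℝ)⁻¹ : ℝ) : EReal) *
      ∑ i ∈ cube d (n + r), A (translate (-i) (cube d n))) atTop ≤ G := by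
  refine le_of_forall_gt_imp_ge_of_dense fun a ha => ?_
  obtain ⟨b, hb, hab⟩ := EReal.lt_iff_exists_real_btwn.1 ha
  obtain ⟨S, hS⟩ := eventually_atTop.1 (hA.eventually (gt_mem_nhds hb))
  obtain ⟨l, hl⟩ := exists_subset_cube S
  have hn0 : ∀ᶠ n : ℕ in atTop, (0 : ℤ) ≤ (n : ℤ) := Eventually.of_forall fun n => by positivity
  have hin : Tendsto (fun n : ℕ => ((cube d n).card : ℝ)⁻¹ * (cube d ((n : ℤ) - l)).card) atTop
      (𝓝 1) := by
    refine tendsto_card_cube_ratio (r := fun n => (n : ℤ)) (s := fun n => (n : ℤ) - l) hn0 ?_ ?_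
    · filter_upwards [eventually_ge_atTop l] with n hn
      exact sub_nonneg.2 (by exact_mod_cast hn)
    · refine (tendsto_const_div_add (-l) 1).congr fun n => ?_
      push_cast
      ring
  have hout : Tendsto (fun n : ℕ => ((cube d n).card : ℝ)⁻¹ * (cube d ((n : ℤ) + r)).card) atTop
      (𝓝 1) := by
    refine tendsto_card_cube_ratio (r := fun n => (n : ℤ)) (s := fun n => (n : ℤ) + r) hn0 ?_ ?_
    · exact Eventually.of_forall fun n => by positivity
    · refine (tendsto_const_div_add r 1).congr fun n => ?_
      push_cast
      ring
  have hlim : Tendsto (fun n : ℕ => ((((cube d n).card : ℝ)⁻¹ * (cube d ((n : ℤ) - l)).card * b +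
      (((cube d n).card : ℝ)⁻¹ * (cube d ((n : ℤ) + r)).card -
        ((cube d n).card : ℝ)⁻¹ * (cube d ((n : ℤ) - l)).card) * C : ℝ) : EReal)) atTop
      (𝓝 (b : EReal)) := by
    have h1 := (hin.mul_const b).add ((hout.sub hin).mul_const C)
    rw [sub_self, zero_mul, add_zero, one_mul] at h1
    exact (continuous_coe_real_ereal.tendsto _).comp h1
  refine le_trans ?_ hab.le
  rw [← hlim.limsup_eq]
  refine limsup_le_limsup (Eventually.of_forall fun n => ?_)
  have hsub : cube d ((n : ℤ) - l) ⊆ cube d (n + r) := cube_mono (by linarith)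
  have h1 : ∑ i ∈ cube d (n + r), A (translate (-i) (cube d n)) ≤
      (((cube d ((n : ℤ) - l)).card * b + ((cube d (n + r)).card -
        (cube d ((n : ℤ) - l)).card) * C : ℝ) : EReal) := by
    rw [← Finset.sum_sdiff hsub, add_comm, EReal.coe_add]
    refine add_le_add (sum_le_card_mul fun i hi => ?_) ?_
    · exact (hS _ (hl.trans (subset_translate_cube (by linarith) hi))).le
    · rw [← Nat.cast_sub (Finset.card_le_card hsub), ← Finset.card_sdiff_of_subset hsub]
      exact sum_le_card_mul fun i _ => hC _
  refine (mul_le_mul_of_nonneg_left h1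
    (EReal.coe_nonneg.2 (inv_nonneg.2 (Nat.cast_nonneg _)))).trans (le_of_eq ?_)
  rw [← EReal.coe_mul]
  congr 1
  ring

theorem tendsto_div_two_pow :
    Tendsto (fun n : ℕ => ((((2 ^ n - n - 1) - (2 ^ n - 1) : ℤ) : ℤ) : ℝ) /
      (2 * (((2 ^ n - 1 : ℤ) : ℤ) : ℝ) + 1)) atTop (𝓝 0) := by
  have h1 : Tendsto (fun n : ℕ => -((n : ℝ) / 2 ^ n)) atTop (𝓝 (-0)) :=
    (by simpa using tendsto_pow_const_div_const_pow_of_one_lt 1 (one_lt_two (α := ℝ)) :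
      Tendsto (fun n : ℕ => (n : ℝ) / 2 ^ n) atTop (𝓝 0)).neg
  rw [neg_zero] at h1
  refine squeeze_zero_norm (a := fun n : ℕ => (n : ℝ) / 2 ^ n) (fun n => ?_) (by simpa using h1.neg)
  have h2 : (1 : ℝ) ≤ 2 ^ n := one_le_pow₀ one_le_two
  push_cast
  rw [Real.norm_eq_abs, abs_div, abs_of_pos (show (0 : ℝ) < 2 * (2 ^ n - 1) + 1 by linarith),
    show (2 : ℝ) ^ n - n - 1 - (2 ^ n - 1) = -n by ring, abs_neg, abs_of_nonneg (Nat.cast_nonneg n)]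
  exact div_le_div_of_nonneg_left (Nat.cast_nonneg n) (by positivity) (by linarith)

theorem rate_eq_zero_of_not_subset {c : JumpRates d q} (hti : c.TranslationInvariant)
    {Γ : Finset (Site d)} (hΓ : ∀ Δ : Finset (Site d), 0 ∈ Δ → ¬ Δ ⊆ Γ → c.maxRate Δ = 0)
    {r : ℕ} (hr : Γ ⊆ cube d r) {m : ℤ} {Δ : Finset (Site d)} (h : ¬ Disjoint Δ (cube d m))
    (hΔ : ¬ Δ ⊆ cube d (m + r)) (η : Config d q) (σ : Δ → Fin q) : c.rate Δ η σ = 0 := by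
  obtain ⟨j, hj, hjm⟩ := Finset.not_disjoint_iff.1 h
  obtain ⟨D, rfl⟩ : ∃ D, translate j D = Δ := ⟨_, translate_translate_neg j Δ⟩
  rw [hti]
  refine rate_eq_zero_of_maxRate (hΓ D ?_ fun hD => hΔ fun x hx => ?_) _ _
  · rw [mem_translate, sub_self] at hj
    exact hj
  · have h1 := mem_cube.1 (hr (hD (mem_translate.1 hx)))
    have h2 := mem_cube.1 hjm
    refine mem_cube.2 fun k => ?_
    have h3 := h1 k
    rw [Pi.sub_apply] at h3
    constructor <;> linarith [h3.1, h3.2, (h2 k).1, (h2 k).2]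

end Cubes

end Attractor

theorem mainTheorem3 {d q : ℕ} (c : Attractor.JumpRates d q)
    (hwd : c.WellDefined) (hti : c.TranslationInvariant) (hfin : c.FinitelyManyTypes)
    (huc : c.UniformlyContinuousRates) (hmin : c.HasMinimalRate) (htrap : c.NoTrapStates) :
    ∃ gt : Attractor.InvMeasure d q → EReal,
      (∀ ν, Attractor.IsApproxEntropyLoss c ν (gt ν) ∧ gt ν < ⊤) ∧
      (∀ ν, limsup (fun n : ℕ => Attractor.entropyLossIn c ν (Attractor.cube d n)) atTop ≤ gt ν) ∧
      (∀ ν g, Attractor.IsSpecificEntropyLoss c ν g → g ≤ gt ν) ∧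
      UpperSemicontinuous gt := by
  open Attractor in
  obtain ⟨Γ, -, hΓ⟩ := hfin
  have hlimsup (ν : InvMeasure d q) :
      limsup (fun n : ℕ => entropyLossIn c ν (cube d n)) atTop ≤ lossDensity c Γ ν := by
    obtain ⟨r, hr⟩ := exists_subset_cube Γ
    obtain ⟨C, hC⟩ := exists_originLoss_le c Γ ν
    refine le_trans (limsup_le_limsup (Eventually.of_forall fun n => ?_))
      (limsup_average_le (tendsto_originLoss huc hmin Γ ν).2 hC r)
    refine (entropyLossIn_le (cube_nonempty (Int.natCast_nonneg n))
      (fun Δ h hΔ => rate_eq_zero_of_not_subset hti hΓ hr h hΔ) ν).trans (le_of_eq ?_)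
    simp only [siteLoss_eq_originLoss hti hΓ]
  refine ⟨lossDensity c Γ, fun ν => ⟨?_, (tendsto_originLoss huc hmin Γ ν).1⟩, hlimsup,
    fun ν g hg => hg.limsup_eq.symm.trans_le (hlimsup ν), upperSemicontinuous_lossDensity c Γ⟩
  have hlt (n : ℕ) : (n : ℤ) + 1 ≤ 2 ^ n := by exact_mod_cast Nat.lt_two_pow_self (n := n)
  unfold IsApproxEntropyLoss
  simp only [approxEntropyLoss_eq, siteLoss_eq_originLoss hti hΓ]
  refine tendsto_average (r := fun n => 2 ^ n - 1) (s := fun n => 2 ^ n - n - 1)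
    (tendsto_originLoss huc hmin Γ ν).2 ?_ ?_ ?_
    tendsto_div_two_pow
  · exact Eventually.of_forall fun n => by linarith [hlt n, Int.natCast_nonneg n]
  · exact Eventually.of_forall fun n => by linarith [hlt n]
  · refine tendsto_natCast_atTop_atTop.congr fun n => ?_
    ring
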